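/- **Theorem.** Let $H_1,G_1$ be Hilbert spaces over $\mathbb K\in\{\mathbb R,\mathbb C\}$, let $S_1\colon H_1\to G_1$ be a compact linear operator, and for $d\in\mathbb N=\{1,2,\dots\}$ let $S_d=S_1\otimes\cdots\otimes S_1\colon H_d\to G_d$ be its $d$-fold tensor power, where $H_d=H_1\otimes\cdots\otimes H_1$ and $G_d=G_1\otimes\cdots\otimes G_1$ ($d$ factors) are Hilbert space tensor products. Let $\lambda_1\ge\lambda_2\ge\dots\ge 0$ be the eigenvalues of $W_1=S_1^*S_1$ in non-increasing order, counted with multiplicity (extended by zeros if there are only finitely many positive ones), assume $\lambda_2>0$, and let $m$ be the multiplicity of the largest eigenvalue $\lambda_1$, i.e. $\lambda_1=\dots=\lambda_m>\lambda_{m+1}$. For $n\in\mathbb N_0$ let $$e(n,d)=\inf_{L_1,\dots,L_n,\;\varphi}\ \sup_{\|f\|_{H_d}\le 1}\bigl\|S_d f-\varphi(L_1f,\dots,L_nf)\bigr\|_{G_d},$$ where the infimum is over all continuous linear functionals $L_1,\dots,L_n$ on $H_d$ and all linear maps $\varphi\colon\mathbb K^n\to G_d$, and let $n(\varepsilon,S_d)=\min\{n\in\mathbb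 N_0 : e(n,d)\le\varepsilon\, e(0,d)\}$ be the information complexity for the normalized error criterion. For $s,t>0$ the problem $S=(S_d)_{d\in\mathbb N}$ is called $(s,t)$-weakly tractable if $$\lim_{k\to\infty}\frac{\ln n(\varepsilon_k,S_{d_k})}{\varepsilon_k^{-s}+d_k^{\,t}}=0$$ for all sequences $(\varepsilon_k,d_k)_{k\in\mathbb N}$ in $(0,1)\times\mathbb N$ with $\varepsilon_k^{-1}+d_k\to\infty$. Let $s,t>0$. * If $m=1$, then $S$ is $(s,t)$-weakly tractable if and only if $\displaystyle\lim_{n\to\infty}\frac{\lambda_n}{\ln^{-2/s} n}=0$. * If $m>1$, then $S$ is $(s,t)$-weakly tractable if and only if $t>1$ and $\displaystyle\lim_{n\to\infty}\frac{\lambda_n}{\ln^{-2/s} n}=0$. -/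

import Mathlib

open Filter Topology
open scoped TensorProduct

noncomputable section

/-! ### Hilbert space tensor powers -/

/-- The algebraic `d`-fold tensor power of `E`. (A separate name, because Mathlib puts the
projective seminorm on `⨂[𝕜] _ : Fin d, E`, whereas here it carries the Hilbert space norm.) -/
def AlgTensorPower (𝕜 E : Type*) [RCLike 𝕜] [NormedAddCommGroup E] [InnerProductSpace 𝕜 E]
    (d : ℕ) : Type _ :=
  ⨂[𝕜] _ : Fin d, E

namespace AlgTensorPower

variable {𝕜 E F : Type*} [RCLike 𝕜] [NormedAddCommGroup E] [InnerProductSpace 𝕜 E]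
  [NormedAddCommGroup F] [InnerProductSpace 𝕜 F] {d : ℕ}

instance : AddCommGroup (AlgTensorPower 𝕜 E d) :=
  inferInstanceAs (AddCommGroup (⨂[𝕜] _ : Fin d, E))

instance : Module 𝕜 (AlgTensorPower 𝕜 E d) :=
  inferInstanceAs (Module 𝕜 (⨂[𝕜] _ : Fin d, E))

/-- The elementary tensor `x₁ ⊗ ⋯ ⊗ x_d`. -/
def tprod : MultilinearMap 𝕜 (fun _ : Fin d => E) (AlgTensorPower 𝕜 E d) :=
  PiTensorProduct.tprod 𝕜

/-- The `d`-fold algebraic tensor power `T ⊗ ⋯ ⊗ T` of a linear map. -/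
def map (T : E →ₗ[𝕜] F) : AlgTensorPower 𝕜 E d →ₗ[𝕜] AlgTensorPower 𝕜 F d :=
  PiTensorProduct.map fun _ => T

theorem map_tprod (T : E →ₗ[𝕜] F) (x : Fin d → E) :
    map T (tprod (𝕜 := 𝕜) x) = tprod (𝕜 := 𝕜) fun i => T (x i) :=
  PiTensorProduct.map_tprod _ _

/-- The linear functional with `x₁ ⊗ ⋯ ⊗ x_d ↦ ∏ᵢ ⟪yᵢ, xᵢ⟫`. -/
def pairing (y : Fin d → E) : AlgTensorPower 𝕜 E d →ₗ[𝕜] 𝕜 :=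
  PiTensorProduct.lift
    ((MultilinearMap.mkPiAlgebra 𝕜 (Fin d) 𝕜).compLinearMap fun i => innerₛₗ 𝕜 (y i))

theorem pairing_tprod (y x : Fin d → E) :
    pairing y (tprod (𝕜 := 𝕜) x) = ∏ i, inner 𝕜 (y i) (x i) := by
  unfold pairing tprod
  erw [PiTensorProduct.lift.tprod]
  simp

@[elab_as_elim]
theorem induction {p : AlgTensorPower 𝕜 E d → Prop} (z : AlgTensorPower 𝕜 E d)
    (smul : ∀ (c : 𝕜) (x : Fin d → E), p (c • tprod x)) (add : ∀ z w, p z → p w → p (z + w)) :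
    p z :=
  PiTensorProduct.induction_on z smul (fun {z w} => add z w)

theorem pairing_update_add (y : Fin d → E) (i : Fin d) (a b : E) (z : AlgTensorPower 𝕜 E d) :
    pairing (Function.update y i (a + b)) z =
      pairing (Function.update y i a) z + pairing (Function.update y i b) z := by
  induction z using induction with
  | smul c x =>
    have key : ∀ v : E, ∏ j, inner 𝕜 (Function.update y i v j) (x j) =
        inner 𝕜 v (x i) * ∏ j ∈ Finset.univ.erase i, inner 𝕜 (y j) (x j) := by
      intro v
      rw [← Finset.mul_prod_erase _ _ (Finset.mem_univ i), Function.update_self]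
      congr 1
      refine Finset.prod_congr rfl fun j hj => ?_
      rw [Function.update_of_ne (Finset.ne_of_mem_erase hj)]
    simp only [LinearMap.map_smul, pairing_tprod, key, inner_add_left, smul_eq_mul]
    ring
  | add z w hz hw => simp only [_root_.map_add, hz, hw]; ring

theorem pairing_update_smul (y : Fin d → E) (i : Fin d) (c : 𝕜) (a : E)
    (z : AlgTensorPower 𝕜 E d) :
    pairing (Function.update y i (c • a)) z =
      (starRingEnd 𝕜) c * pairing (Function.update y i a) z := by
  induction z using induction with
  | smul c' x =>
    have key : ∀ v : E, ∏ j, inner 𝕜 (Function.update y i v j) (x j) =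
        inner 𝕜 v (x i) * ∏ j ∈ Finset.univ.erase i, inner 𝕜 (y j) (x j) := by
      intro v
      rw [← Finset.mul_prod_erase _ _ (Finset.mem_univ i), Function.update_self]
      congr 1
      refine Finset.prod_congr rfl fun j hj => ?_
      rw [Function.update_of_ne (Finset.ne_of_mem_erase hj)]
    simp only [LinearMap.map_smul, pairing_tprod, key, inner_smul_left, smul_eq_mul]
    ring
  | add z w hz hw => simp only [_root_.map_add, hz, hw]; ring

/-- The linear functional `⟪z, ·⟫`, determined by
`y₁ ⊗ ⋯ ⊗ y_d ↦ conj (pairing y z)`. -/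
def innerFunctional (z : AlgTensorPower 𝕜 E d) : AlgTensorPower 𝕜 E d →ₗ[𝕜] 𝕜 :=
  PiTensorProduct.lift
    (MultilinearMap.mk' (fun y : Fin d → E => (starRingEnd 𝕜) (pairing y z))
      (fun y i a b => by rw [pairing_update_add, _root_.map_add])
      (fun y i c a => by rw [pairing_update_smul, map_mul, RCLike.conj_conj, smul_eq_mul]))

theorem innerFunctional_tprod (z : AlgTensorPower 𝕜 E d) (y : Fin d → E) :
    innerFunctional z (tprod (𝕜 := 𝕜) y) = (starRingEnd 𝕜) (pairing y z) := by
  unfold innerFunctional tprod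
  erw [PiTensorProduct.lift.tprod]
  rfl

/-- The inner product of the tensor power, the sesquilinear form with
`⟪x₁ ⊗ ⋯ ⊗ x_d, y₁ ⊗ ⋯ ⊗ y_d⟫ = ∏ᵢ ⟪xᵢ, yᵢ⟫`. -/
instance : Inner 𝕜 (AlgTensorPower 𝕜 E d) := ⟨fun z w => innerFunctional z w⟩

theorem inner_def' (z w : AlgTensorPower 𝕜 E d) : inner 𝕜 z w = innerFunctional z w := rfl

theorem inner_tprod (x y : Fin d → E) :
    inner 𝕜 (tprod (𝕜 := 𝕜) x) (tprod (𝕜 := 𝕜) y) = ∏ i, inner 𝕜 (x i) (y i) := by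
  rw [inner_def', innerFunctional_tprod, pairing_tprod, map_prod]
  simp

theorem inner_add_right' (z w w' : AlgTensorPower 𝕜 E d) :
    inner 𝕜 z (w + w') = inner 𝕜 z w + inner 𝕜 z w' := (innerFunctional z).map_add _ _

theorem inner_smul_right' (c : 𝕜) (z w : AlgTensorPower 𝕜 E d) :
    inner 𝕜 z (c • w) = c * inner 𝕜 z w := (innerFunctional z).map_smul _ _

theorem inner_add_left' (z z' w : AlgTensorPower 𝕜 E d) :
    inner 𝕜 (z + z') w = inner 𝕜 z w + inner 𝕜 z' w := by
  induction w using induction with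
  | smul c x =>
    rw [inner_smul_right', inner_smul_right', inner_smul_right', inner_def', inner_def',
      inner_def', innerFunctional_tprod, innerFunctional_tprod, innerFunctional_tprod,
      _root_.map_add, _root_.map_add]
    ring
  | add v w hv hw => simp only [inner_add_right', hv, hw]; ring

theorem inner_smul_left' (c : 𝕜) (z w : AlgTensorPower 𝕜 E d) :
    inner 𝕜 (c • z) w = (starRingEnd 𝕜) c * inner 𝕜 z w := by
  induction w using induction with
  | smul c x =>
    rw [inner_smul_right', inner_smul_right', inner_def', inner_def', innerFunctional_tprod,
      innerFunctional_tprod, LinearMap.map_smul, smul_eq_mul, map_mul]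
    ring
  | add v w hv hw => simp only [inner_add_right', hv, hw]; ring

theorem inner_conj_symm' (z w : AlgTensorPower 𝕜 E d) :
    (starRingEnd 𝕜) (inner 𝕜 w z) = inner 𝕜 z w := by
  induction z using induction with
  | smul c x =>
    induction w using induction with
    | smul c' y =>
      simp only [inner_smul_right', inner_smul_left', inner_tprod, map_mul, map_prod,
        inner_conj_symm, RCLike.conj_conj]
      ring
    | add v w hv hw =>
      simp only [inner_add_right', inner_add_left', _root_.map_add, hv, hw]
  | add v w hv hw => simp only [inner_add_right', inner_add_left', _root_.map_add, hv, hw]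

theorem inner_sum_right' {κ : Type*} (s : Finset κ) (z : AlgTensorPower 𝕜 E d)
    (f : κ → AlgTensorPower 𝕜 E d) : inner 𝕜 z (∑ k ∈ s, f k) = ∑ k ∈ s, inner 𝕜 z (f k) :=
  map_sum (innerFunctional z) _ _

theorem inner_sum_left' {κ : Type*} (s : Finset κ) (z : AlgTensorPower 𝕜 E d)
    (f : κ → AlgTensorPower 𝕜 E d) : inner 𝕜 (∑ k ∈ s, f k) z = ∑ k ∈ s, inner 𝕜 (f k) z := by
  rw [← inner_conj_symm', inner_sum_right', map_sum]
  exact Finset.sum_congr rfl fun k _ => inner_conj_symm' _ _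

theorem exists_finiteDimensional (z : AlgTensorPower 𝕜 E d) :
    ∃ V : Submodule 𝕜 E, FiniteDimensional 𝕜 V ∧
      ∃ z' : AlgTensorPower 𝕜 V d, map V.subtype z' = z := by
  induction z using induction with
  | smul c x =>
    refine ⟨Submodule.span 𝕜 (Set.range x), FiniteDimensional.span_of_finite 𝕜
      (Set.finite_range x), c • tprod fun i => ⟨x i, Submodule.subset_span ⟨i, rfl⟩⟩, ?_⟩
    rw [LinearMap.map_smul, map_tprod]
    rfl
  | add z w hz hw =>
    obtain ⟨V, hV, z', rfl⟩ := hz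
    obtain ⟨W, hW, w', rfl⟩ := hw
    refine ⟨V ⊔ W, inferInstance, map (Submodule.inclusion le_sup_left) z' +
      map (Submodule.inclusion le_sup_right) w', ?_⟩
    have h : ∀ (U : Submodule 𝕜 E) (hU : U ≤ V ⊔ W) (u : AlgTensorPower 𝕜 U d),
        map (V ⊔ W).subtype (map (Submodule.inclusion hU) u) = map U.subtype u := by
      intro U hU u
      induction u using induction with
      | smul c x => simp only [LinearMap.map_smul, map_tprod]; rfl
      | add a b ha hb => simp only [_root_.map_add, ha, hb]
    rw [_root_.map_add, h, h]

/-- Diagonal form of the inner product of images under a tensor power `T ⊗ ⋯ ⊗ T`. -/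
theorem inner_map_self {κ : Type*} [Fintype κ] [DecidableEq κ] (b : Module.Basis κ 𝕜 E)
    (T : E →ₗ[𝕜] F) (μ : κ → ℝ) (h : ∀ i j, inner 𝕜 (T (b i)) (T (b j)) = if i = j then (μ i : 𝕜)
      else 0) (z : AlgTensorPower 𝕜 E d) :
    inner 𝕜 (map T z) (map T z) =
      ((∑ p : Fin d → κ, ‖(Basis.piTensorProduct fun _ : Fin d => b).repr z p‖ ^ 2 *
        ∏ i, μ (p i) : ℝ) : 𝕜) := by
  classical
  set c := (Basis.piTensorProduct fun _ : Fin d => b).repr z with hc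
  have hz : z = ∑ p : Fin d → κ, c p • tprod fun i => b (p i) := by
    conv_lhs => rw [← (Basis.piTensorProduct fun _ : Fin d => b).sum_repr z]
    refine Finset.sum_congr rfl fun p _ => ?_
    rw [Basis.piTensorProduct_apply]
    rfl
  have hT : map T z = ∑ p : Fin d → κ, c p • tprod fun i => T (b (p i)) := by
    conv_lhs => rw [hz]
    rw [map_sum]
    exact Finset.sum_congr rfl fun p _ => by rw [LinearMap.map_smul, map_tprod]
  have hprod : ∀ p q : Fin d → κ, ∏ i, inner 𝕜 (T (b (p i))) (T (b (q i))) =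
      if p = q then ((∏ i, μ (p i) : ℝ) : 𝕜) else 0 := by
    intro p q
    split_ifs with hpq
    · subst hpq
      rw [RCLike.ofReal_prod]
      exact Finset.prod_congr rfl fun i _ => by rw [h, if_pos rfl]
    · obtain ⟨i, hi⟩ := Function.ne_iff.mp hpq
      exact Finset.prod_eq_zero (Finset.mem_univ i) (by rw [h, if_neg hi])
  rw [hT, inner_sum_left', RCLike.ofReal_sum]
  refine Finset.sum_congr rfl fun p _ => ?_
  rw [inner_sum_right', Finset.sum_eq_single p]
  · rw [inner_smul_left', inner_smul_right', inner_tprod, hprod, if_pos rfl, ← mul_assoc,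
      RCLike.conj_mul]
    push_cast
    rfl
  · intro q _ hq
    rw [inner_smul_left', inner_smul_right', inner_tprod, hprod, if_neg (Ne.symm hq)]
    simp
  · simp

theorem exists_repr (z : AlgTensorPower 𝕜 E d) :
    ∃ (V : Submodule 𝕜 E) (_ : FiniteDimensional 𝕜 V) (z' : AlgTensorPower 𝕜 V d),
      map V.subtype z' = z ∧
      ∀ {n : ℕ} (b : OrthonormalBasis (Fin n) 𝕜 V), inner 𝕜 z z =
        ((∑ p : Fin d → Fin n,
          ‖(Basis.piTensorProduct fun _ : Fin d => b.toBasis).repr z' p‖ ^ 2 : ℝ) : 𝕜) := by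
  obtain ⟨V, hV, z', rfl⟩ := exists_finiteDimensional z
  refine ⟨V, hV, z', rfl, fun {n} b => ?_⟩
  rw [inner_map_self b.toBasis V.subtype (fun _ => 1)]
  · simp
  · intro i j
    have := b.inner_eq_ite i j
    simpa using this

/-- The inner product of the algebraic tensor power is positive definite. -/
@[reducible]
def core : InnerProductSpace.Core 𝕜 (AlgTensorPower 𝕜 E d) where
  conj_inner_symm := inner_conj_symm'
  add_left := inner_add_left'
  smul_left z w c := inner_smul_left' c z w
  re_inner_nonneg z := by
    obtain ⟨V, hV, z', -, h⟩ := exists_repr z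
    rw [h (stdOrthonormalBasis 𝕜 V), RCLike.ofReal_re]
    positivity
  definite z hz := by
    obtain ⟨V, hV, z', rfl, h⟩ := exists_repr z
    rw [h (stdOrthonormalBasis 𝕜 V), RCLike.ofReal_eq_zero,
      Finset.sum_eq_zero_iff_of_nonneg fun _ _ => sq_nonneg _] at hz
    have : z' = 0 := by
      apply (Basis.piTensorProduct fun _ : Fin d => (stdOrthonormalBasis 𝕜 V).toBasis).ext_elem
      intro p
      have := hz p (Finset.mem_univ p)
      erw [map_zero]
      simpa using this
    rw [this, map_zero]

instance : NormedAddCommGroup (AlgTensorPower 𝕜 E d) :=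
  (core (𝕜 := 𝕜)).toNormedAddCommGroup

instance : InnerProductSpace 𝕜 (AlgTensorPower 𝕜 E d) :=
  InnerProductSpace.ofCore (core (𝕜 := 𝕜)).toCore

theorem norm_map_le [CompleteSpace F] (T : E →L[𝕜] F) (z : AlgTensorPower 𝕜 E d) :
    ‖map T.toLinearMap z‖ ≤ ‖T‖ ^ d * ‖z‖ := by
  obtain ⟨V, hV, z', rfl, h⟩ := exists_repr z
  let A : V →L[𝕜] F := T ∘L V.subtypeL
  have hS : (ContinuousLinearMap.adjoint A ∘L A).toLinearMap.IsSymmetric := by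
    intro x y
    simp [ContinuousLinearMap.adjoint_inner_left, ContinuousLinearMap.adjoint_inner_right]
  let b := hS.eigenvectorBasis rfl
  let μ := hS.eigenvalues rfl
  have hb : ∀ i j, inner 𝕜 (A (b i)) (A (b j)) = if i = j then (μ i : 𝕜) else 0 := by
    intro i j
    have h1 : inner 𝕜 (A (b i)) (A (b j)) = inner 𝕜 ((ContinuousLinearMap.adjoint A ∘L A) (b i))
        (b j) := by simp [ContinuousLinearMap.adjoint_inner_left]
    have h2 : (ContinuousLinearMap.adjoint A ∘L A) (b i) = (μ i : 𝕜) • b i :=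
      hS.apply_eigenvectorBasis rfl i
    rw [h1, h2, inner_smul_left, b.inner_eq_ite, RCLike.conj_ofReal]
    simp
  have hμ : ∀ i, μ i = ‖A (b i)‖ ^ 2 := by
    intro i
    have := hb i i
    rw [if_pos rfl, inner_self_eq_norm_sq_to_K] at this
    exact_mod_cast this.symm
  have hμ0 : ∀ i, 0 ≤ μ i := fun i => by rw [hμ]; positivity
  have hμ1 : ∀ i, μ i ≤ ‖T‖ ^ 2 := fun i => by
    rw [hμ]
    have h3 : ‖A (b i)‖ ≤ ‖T‖ * ‖b i‖ := T.le_opNorm _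
    rw [b.norm_eq_one, mul_one] at h3
    gcongr
  have hcomp : map T.toLinearMap (map V.subtype z') = map A.toLinearMap z' := by
    clear h
    induction z' using induction with
    | smul c x => simp only [LinearMap.map_smul, map_tprod]; rfl
    | add z w hz hw => simp only [_root_.map_add, hz, hw]
  have h4 : ‖map V.subtype z'‖ ^ 2 = ∑ p : Fin d → Fin (Module.finrank 𝕜 V),
      ‖(Basis.piTensorProduct fun _ : Fin d => b.toBasis).repr z' p‖ ^ 2 := by
    have := h b
    rw [inner_self_eq_norm_sq_to_K] at this
    exact_mod_cast this
  have h5 : ‖map A.toLinearMap z'‖ ^ 2 = ∑ p : Fin d → Fin (Module.finrank 𝕜 V),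
      ‖(Basis.piTensorProduct fun _ : Fin d => b.toBasis).repr z' p‖ ^ 2 * ∏ i, μ (p i) := by
    have := inner_map_self b.toBasis A.toLinearMap μ (by simpa using hb) z'
    rw [inner_self_eq_norm_sq_to_K] at this
    exact_mod_cast this
  rw [hcomp]
  refine le_of_sq_le_sq ?_ (by positivity)
  rw [h5, mul_pow, h4, Finset.mul_sum]
  refine Finset.sum_le_sum fun p _ => ?_
  rw [mul_comm]
  gcongr
  calc ∏ i, μ (p i) ≤ ∏ _i : Fin d, ‖T‖ ^ 2 :=
        Finset.prod_le_prod (fun i _ => hμ0 _) fun i _ => hμ1 _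
    _ = (‖T‖ ^ d) ^ 2 := by simp [← pow_mul, mul_comm]

/-- The tensor power `T ⊗ ⋯ ⊗ T` as a continuous linear map for the Hilbert space norms. -/
def mapL [CompleteSpace F] (T : E →L[𝕜] F) :
    AlgTensorPower 𝕜 E d →L[𝕜] AlgTensorPower 𝕜 F d :=
  (map T.toLinearMap).mkContinuous (‖T‖ ^ d) (norm_map_le T)

end AlgTensorPower

/-- The `d`-fold Hilbert space tensor power `E ⊗ ⋯ ⊗ E`: the completion of the algebraic tensor
power with respect to `⟪x₁ ⊗ ⋯ ⊗ x_d, y₁ ⊗ ⋯ ⊗ y_d⟫ = ∏ᵢ ⟪xᵢ, yᵢ⟫`. -/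
abbrev HilbertTensorPower (𝕜 E : Type*) [RCLike 𝕜] [NormedAddCommGroup E] [InnerProductSpace 𝕜 E]
    (d : ℕ) : Type _ :=
  UniformSpace.Completion (AlgTensorPower 𝕜 E d)

/-- The linear tensor product problem generated by `S₁`: the operator
`S_d = S₁ ⊗ ⋯ ⊗ S₁ : H ⊗ ⋯ ⊗ H → G ⊗ ⋯ ⊗ G`, the continuous linear extension of
`x₁ ⊗ ⋯ ⊗ x_d ↦ S₁ x₁ ⊗ ⋯ ⊗ S₁ x_d`. -/
def tensorProductProblem {𝕜 H G : Type*} [RCLike 𝕜] [NormedAddCommGroup H]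
    [InnerProductSpace 𝕜 H] [NormedAddCommGroup G] [InnerProductSpace 𝕜 G] [CompleteSpace G]
    (S₁ : H →L[𝕜] G) (d : ℕ) : HilbertTensorPower 𝕜 H d →L[𝕜] HilbertTensorPower 𝕜 G d :=
  (AlgTensorPower.mapL S₁).completion

/-! ### Worst case error and information complexity -/

/-- The worst case error over the closed unit ball of approximating `S` by `A`. -/
def worstCaseError {E F : Type*} [NormedAddCommGroup E] [NormedAddCommGroup F]
    (S A : E → F) : ℝ :=
  ⨆ f : Metric.closedBall (0 : E) 1, ‖S f - A f‖

/-- The linear algorithm `f ↦ φ (L₁ f, …, L_n f)` which uses the `n` pieces of information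
`L₁ f, …, L_n f`, where the `L_i` are arbitrary continuous linear functionals. -/
def linearAlgorithm {𝕜 E F : Type*} [RCLike 𝕜] [NormedAddCommGroup E] [NormedSpace 𝕜 E]
    [NormedAddCommGroup F] [NormedSpace 𝕜 F] {n : ℕ} (L : Fin n → (E →L[𝕜] 𝕜))
    (φ : (Fin n → 𝕜) →ₗ[𝕜] F) : E → F :=
  fun f => φ fun i => L i f

/-- The `n`-th minimal worst case error `e(n)` of the problem `S`, for deterministic linear
nonadaptive algorithms and information from the class of all continuous linear functionals. -/
def minimalError {𝕜 E F : Type*} [RCLike 𝕜] [NormedAddCommGroup E] [NormedSpace 𝕜 E]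
    [NormedAddCommGroup F] [NormedSpace 𝕜 F] (S : E →L[𝕜] F) (n : ℕ) : ℝ :=
  ⨅ A : (Fin n → (E →L[𝕜] 𝕜)) × ((Fin n → 𝕜) →ₗ[𝕜] F),
    worstCaseError S (linearAlgorithm A.1 A.2)

/-- The information complexity for the normalized error criterion,
`n(ε, S) = min {n | e(n) ≤ ε e(0)}`; `e(0)` is the initial error. -/
def normalizedInfoComplexity {𝕜 E F : Type*} [RCLike 𝕜] [NormedAddCommGroup E] [NormedSpace 𝕜 E]
    [NormedAddCommGroup F] [NormedSpace 𝕜 F] (ε : ℝ) (S : E →L[𝕜] F) : ℕ :=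
  sInf {n : ℕ | minimalError S n ≤ ε * minimalError S 0}

/-! ### `(s,t)`-weak tractability -/

/-- `(s,t)`-weak tractability for the normalized error criterion of a problem whose information
complexity is `n ε d`: `ln n(ε, d) / (ε⁻ˢ + dᵗ) → 0` as `ε⁻¹ + d → ∞`, that is, along all
sequences `(ε_k, d_k)` with `0 < ε_k < 1`, `d_k ≥ 1` and `ε_k⁻¹ + d_k → ∞`. -/
def IsWeaklyTractable (s t : ℝ) (n : ℝ → ℕ → ℕ) : Prop :=
  ∀ (ε : ℕ → ℝ) (d : ℕ → ℕ), (∀ k, 0 < ε k ∧ ε k < 1) → (∀ k, 1 ≤ d k) →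
    Tendsto (fun k => (ε k)⁻¹ + (d k : ℝ)) atTop atTop →
    Tendsto (fun k => Real.log (n (ε k) (d k)) / ((ε k) ^ (-s) + (d k : ℝ) ^ t)) atTop (𝓝 0)

/-! ### Eigenvalues -/

/-- For a positive compact operator `W` and `n ≥ 1`: the `n`-th largest eigenvalue of `W`, counted
with multiplicity (and `0` if `W` has fewer than `n` positive eigenvalues). It is the largest `μ`
for which there are `n` orthonormal eigenvectors of `W` with eigenvalues at least `μ`. -/
def orderedEigenvalue {𝕜 E : Type*} [RCLike 𝕜] [NormedAddCommGroup E] [InnerProductSpace 𝕜 E]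
    (W : E →L[𝕜] E) (n : ℕ) : ℝ :=
  sSup {μ : ℝ | ∃ (v : Fin n → E) (c : Fin n → ℝ), Orthonormal 𝕜 v ∧
    ∀ i, W (v i) = (c i : 𝕜) • v i ∧ μ ≤ c i}

end

/-!
The information complexity of `S_d` is a counting function of singular values. For an operator with
orthogonal images of an orthonormal family, `n` functionals cannot separate `0` from a vector in the
span of more than `n` of its members, while projecting onto the members with large singular values
is optimal once everything else is mapped to something small. For `S_d = S₁ ⊗ ⋯ ⊗ S₁` this gives
(`normalizedInfoComplexity_tensorProductProblem`)
`n(ε, S_d) = #{p ∈ ℕ^d | ∏ a_{p_i} > ε²}`, where `a_j = λ_{j+1} / λ_1`.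
The only spectral input is a diagonalization of `S₁` above a threshold `τ > 0`
(`exists_truncated_diagonalization`): an algebraic tensor lies in the tensor power of a
finite-dimensional subspace, which has a basis that extends the finitely many large eigenvectors and
is mapped by `S₁` to an orthogonal family, so no infinite orthonormal basis of the tensor power is
needed.

The rest concerns the sequence `a`, with `a_0 = ⋯ = a_{m-1} = 1 > a_m` and `a_j → 0`. Put
`z_j = a_j^(-s/2)`. The decay condition says `log j ≤ δ z_j` eventually, for each `δ > 0`.

*Sufficiency.* Give the index `j < m` the weight `1` and `j ≥ m` the weight `exp (-δ z_j - C) / d`.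
The decay condition makes the total weight at most `m + 1/d` for suitable `C`, so all `d`-tuples
together weigh at most `e m^d`. In a counted tuple let `T` be the set of coordinates with index
`≥ m`. There `z ≥ c > 1` for a constant `c`, and `∏_T z ≤ ε^(-s)`; hence `|T| = O(log ε⁻¹)`, and
`∑_T z ≤ c / (c - 1) ∏_T z` (`Finset.sum_le_const_mul_prod`). So every counted tuple has weight at
least `exp (-O(δ) ε^(-s) - (C + log d) O(log ε⁻¹))`, and
(`LogDecay.exists_log_productCount_le`)
`log n(ε, S_d) ≤ 1 + d log m + O(δ) ε^(-s) + (C + log d) O(log ε⁻¹)`.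
The last product is of lower order than `ε^(-s) + d^t`, and so is `d log m` if `m = 1` or `t > 1`.

*Necessity.* The case `d = 1` with `ε² = a_j / 2` gives the decay condition, since then at least
`j + 1` indices are counted. For `m > 1` and `ε = 1/2` at least `m^d` tuples are counted, so `d` must be
of lower order than `d^t`.
-/

noncomputable section

/-! ### Spectral decomposition of a compact operator above a threshold -/

section Spectral

open Module.End

variable {𝕜 E F : Type*} [RCLike 𝕜] [NormedAddCommGroup E] [InnerProductSpace 𝕜 E]
  [NormedAddCommGroup F] [InnerProductSpace 𝕜 F]

/-- A vector in the span of eigenspaces has finitely many orthogonal components, whose squared norms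
`r i` compute both its norm and its quadratic form. -/
theorem LinearMap.IsSymmetric.exists_sum_eigencomponents {T : E →ₗ[𝕜] E} (hT : T.IsSymmetric)
    {ι : Type*} {κ : ι → 𝕜} (hκ : Function.Injective κ) {x : E}
    (hx : x ∈ ⨆ i, eigenspace T (κ i)) :
    ∃ (s : Finset ι) (r : ι → ℝ), (∀ i, 0 ≤ r i) ∧ ‖x‖ ^ 2 = ∑ i ∈ s, r i ∧
      RCLike.re (inner 𝕜 x (T x)) = ∑ i ∈ s, RCLike.re (κ i) * r i := by
  obtain ⟨f, hf, rfl⟩ := (Submodule.mem_iSup_iff_exists_finsupp _ _).1 hx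
  have hO := hT.orthogonalFamily_eigenspaces.comp hκ
  let l : ∀ i, eigenspace T (κ i) := fun i => ⟨f i, hf i⟩
  have hTf : ∀ i, T (f i) = κ i • f i := fun i => mem_eigenspace_iff.1 (hf i)
  refine ⟨f.support, fun i => ‖f i‖ ^ 2, fun i => sq_nonneg _, ?_, ?_⟩
  · exact hO.norm_sum l f.support
  · have h := hO.inner_sum l (fun i => κ i • l i) f.support
    have h2 : T (f.sum fun _ x => x) = ∑ i ∈ f.support, κ i • f i := by
      rw [Finsupp.sum, map_sum]
      exact Finset.sum_congr rfl fun i _ => hTf i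
    have h3 : inner 𝕜 (f.sum fun _ x => x) (T (f.sum fun _ x => x)) =
        ∑ i ∈ f.support, inner 𝕜 (l i) (κ i • l i) := by
      rw [h2]; exact h
    rw [h3, map_sum]
    refine Finset.sum_congr rfl fun i _ => ?_
    rw [inner_smul_right, inner_self_eq_norm_sq_to_K, ← RCLike.ofReal_pow, RCLike.re_mul_ofReal]
    rfl

variable [CompleteSpace E] [CompleteSpace F] {S : E →L[𝕜] F} {W : E →L[𝕜] E}

theorem inner_gram (hW : W = ContinuousLinearMap.adjoint S ∘L S) (x y : E) :
    inner 𝕜 x (W y) = inner 𝕜 (S x) (S y) := by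
  simp [hW, ContinuousLinearMap.adjoint_inner_right]

theorem isSymmetric_gram (hW : W = ContinuousLinearMap.adjoint S ∘L S) :
    W.toLinearMap.IsSymmetric := by
  intro x y
  rw [← inner_conj_symm]
  change (starRingEnd 𝕜) (inner 𝕜 y (W x)) = inner 𝕜 x (W y)
  rw [inner_gram hW, inner_gram hW, inner_conj_symm]

theorem re_inner_gram_self (hW : W = ContinuousLinearMap.adjoint S ∘L S) (x : E) :
    RCLike.re (inner 𝕜 x (W x)) = ‖S x‖ ^ 2 := by
  rw [inner_gram hW, inner_self_eq_norm_sq]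

theorem mul_norm_sq_of_gram_eq (hW : W = ContinuousLinearMap.adjoint S ∘L S) {x : E} {c : ℝ}
    (hx : W x = (c : 𝕜) • x) : ‖S x‖ ^ 2 = c * ‖x‖ ^ 2 := by
  rw [← re_inner_gram_self hW, hx, inner_smul_right, inner_self_eq_norm_sq_to_K,
    ← RCLike.ofReal_pow, ← RCLike.ofReal_mul, RCLike.ofReal_re]

/-- The span of the eigenvectors of `W` with eigenvalue above `τ`. Eigenvalues are taken in `𝕜` and
compared through their real parts; for symmetric `W` they are real. -/
def spectralSubspace (W : E →L[𝕜] E) (τ : ℝ) : Submodule 𝕜 E :=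
  ⨆ μ : {μ : 𝕜 // τ < RCLike.re μ}, eigenspace W.toLinearMap μ

omit [CompleteSpace E] in
theorem mem_spectralSubspace {τ c : ℝ} (hc : τ < c) {x : E} (hx : W x = (c : 𝕜) • x) :
    x ∈ spectralSubspace W τ :=
  Submodule.mem_iSup_of_mem (p := fun μ : {μ : 𝕜 // τ < RCLike.re μ} =>
    eigenspace W.toLinearMap (μ : 𝕜)) ⟨(c : 𝕜), by simpa using hc⟩ (mem_eigenspace_iff.2 hx)

theorem le_norm_sq_of_mem_spectralSubspace (hW : W = ContinuousLinearMap.adjoint S ∘L S) {τ : ℝ}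
    {x : E} (hx : x ∈ spectralSubspace W τ) : τ * ‖x‖ ^ 2 ≤ ‖S x‖ ^ 2 := by
  obtain ⟨s, r, hr, h1, h2⟩ :=
    (isSymmetric_gram hW).exists_sum_eigencomponents Subtype.val_injective hx
  rw [← re_inner_gram_self hW]
  erw [h2]
  rw [h1, Finset.mul_sum]
  exact Finset.sum_le_sum fun i _ => mul_le_mul_of_nonneg_right i.2.le (hr i)

/-- The Rayleigh quotient is at most `τ` on the orthogonal complement of the spectral subspace: by
the spectral theorem this complement is the closed span of the remaining eigenvectors. -/
theorem norm_sq_le_of_mem_spectralSubspace_orthogonal (hS : IsCompactOperator S)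
    (hW : W = ContinuousLinearMap.adjoint S ∘L S) {τ : ℝ}
    {x : E} (hx : x ∈ (spectralSubspace W τ)ᗮ) : ‖S x‖ ^ 2 ≤ τ * ‖x‖ ^ 2 := by
  have hsymm := isSymmetric_gram hW
  have hcpt : IsCompactOperator W := by
    rw [hW]; exact hS.clm_comp (ContinuousLinearMap.adjoint S)
  let U : Submodule 𝕜 E :=
    ⨆ μ : {μ : 𝕜 // RCLike.re μ ≤ τ}, eigenspace W.toLinearMap μ
  have hbot := ContinuousLinearMap.orthogonalComplement_iSup_eigenspaces_eq_bot hcpt hsymm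
  -- By the spectral theorem the eigenvectors above and below `τ` together are total.
  have hle : (spectralSubspace W τ)ᗮ ⊓ Uᗮ ≤ ⊥ := by
    rw [Submodule.inf_orthogonal]
    refine (Submodule.orthogonal_le (iSup_le fun μ => ?_)).trans hbot.le
    rcases lt_or_ge τ (RCLike.re μ) with h | h
    · exact le_sup_of_le_left (le_iSup (fun μ : {μ : 𝕜 // τ < RCLike.re μ} =>
        eigenspace W.toLinearMap (μ : 𝕜)) ⟨μ, h⟩)
    · exact le_sup_of_le_right (le_iSup (fun μ : {μ : 𝕜 // RCLike.re μ ≤ τ} =>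
        eigenspace W.toLinearMap (μ : 𝕜)) ⟨μ, h⟩)
  have hU : U ≤ (spectralSubspace W τ)ᗮ := by
    rw [← Submodule.isOrtho_iff_le]
    refine Submodule.isOrtho_iSup_left.2 fun μ => Submodule.isOrtho_iSup_right.2 fun ν => ?_
    rw [Submodule.isOrtho_iff_inner_eq]
    intro u hu v hv
    have hne : (μ : 𝕜) ≠ ν := fun h => by
      have h1 := μ.2
      have h2 := ν.2
      rw [h] at h1
      exact absurd h1 (not_le.2 h2)
    exact hsymm.orthogonalFamily_eigenspaces hne ⟨u, hu⟩ ⟨v, hv⟩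
  have hUcl : U.topologicalClosure ≤ (spectralSubspace W τ)ᗮ :=
    Submodule.topologicalClosure_minimal _ hU (Submodule.isClosed_orthogonal _)
  have hxU : x ∈ U.topologicalClosure := by
    obtain ⟨a, ha, b, hb, rfl⟩ :=
      Submodule.exists_add_mem_mem_orthogonal (K := U.topologicalClosure) x
    have hb' : b ∈ (spectralSubspace W τ)ᗮ ⊓ Uᗮ := by
      refine ⟨?_, Submodule.orthogonal_le (Submodule.le_topologicalClosure _) hb⟩
      simpa using Submodule.sub_mem _ hx (hUcl ha)
    have : b = 0 := by simpa using hle hb'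
    simpa [this] using ha
  have hclosed : IsClosed {y : E | ‖S y‖ ^ 2 ≤ τ * ‖y‖ ^ 2} :=
    isClosed_le (by fun_prop) (by fun_prop)
  refine closure_minimal (s := (U : Set E)) (fun y hy => ?_) hclosed hxU
  obtain ⟨s, r, hr, h1, h2⟩ := hsymm.exists_sum_eigencomponents Subtype.val_injective hy
  rw [Set.mem_ofPred_eq, ← re_inner_gram_self hW]
  erw [h2]
  rw [h1, Finset.mul_sum]
  exact Finset.sum_le_sum fun i _ => mul_le_mul_of_nonneg_right i.2 (hr i)

/-- The compact operator `S` is bounded below by `√τ` on the spectral subspace, so a separated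
bounded sequence in that subspace would have an image without a convergent subsequence. -/
theorem finiteDimensional_spectralSubspace (hS : IsCompactOperator S)
    (hW : W = ContinuousLinearMap.adjoint S ∘L S) {τ : ℝ} (hτ : 0 < τ) :
    FiniteDimensional 𝕜 (spectralSubspace W τ) := by
  by_contra hfin
  obtain ⟨R, f, -, hfR, hsep⟩ := exists_seq_norm_le_one_le_norm_sub hfin
  obtain ⟨K, hK, hSK⟩ := IsCompactOperator.image_closedBall_subset_compact (𝕜₁ := 𝕜)
    (f := S.toLinearMap) hS R
  obtain ⟨y, -, φ, hφ, hy⟩ := hK.tendsto_subseq (x := fun n => S (f n)) fun n =>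
    hSK ⟨f n, by simpa using hfR n, rfl⟩
  have hc := Metric.cauchySeq_iff'.1 hy.cauchySeq (√τ) (Real.sqrt_pos.2 hτ)
  obtain ⟨n, hn⟩ := hc
  have h1 := hn (n + 1) (Nat.le_succ n)
  have h2 : 1 ≤ ‖f (φ (n + 1)) - f (φ n)‖ := hsep (hφ (Nat.lt_succ_self n)).ne'
  have h3 := le_norm_sq_of_mem_spectralSubspace hW (f (φ (n + 1)) - f (φ n)).2
  simp only [Function.comp_apply, dist_eq_norm, ← map_sub] at h1
  have h4 : ‖S (f (φ (n + 1)) - f (φ n))‖ ^ 2 < τ := by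
    have := Real.lt_sqrt (norm_nonneg _) |>.1 h1
    exact this
  have h5 : τ ≤ τ * ‖f (φ (n + 1)) - f (φ n)‖ ^ 2 :=
    le_mul_of_one_le_right hτ.le (one_le_pow₀ h2)
  have h6 : ‖((f (φ (n + 1)) - f (φ n) : spectralSubspace W τ) : E)‖ =
    ‖f (φ (n + 1)) - f (φ n)‖ := rfl
  rw [h6] at h3
  exact absurd (h5.trans h3) (not_le.2 h4)

theorem bddAbove_orderedEigenvalue (hW : W = ContinuousLinearMap.adjoint S ∘L S) {n : ℕ}
    (hn : 1 ≤ n) :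
    BddAbove {μ : ℝ | ∃ (v : Fin n → E) (c : Fin n → ℝ), Orthonormal 𝕜 v ∧
      ∀ i, W (v i) = (c i : 𝕜) • v i ∧ μ ≤ c i} := by
  refine ⟨‖S‖ ^ 2, ?_⟩
  rintro μ ⟨v, c, hv, h⟩
  obtain ⟨h1, h2⟩ := h ⟨0, hn⟩
  have h3 := mul_norm_sq_of_gram_eq hW h1
  have h4 := S.le_opNorm (v ⟨0, hn⟩)
  rw [hv.1, mul_one] at h4
  rw [hv.1, one_pow, mul_one] at h3
  rw [← h3] at h2
  exact h2.trans (by gcongr)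

theorem orderedEigenvalue_nonneg (hW : W = ContinuousLinearMap.adjoint S ∘L S) {n : ℕ}
    (hn : 1 ≤ n) : 0 ≤ orderedEigenvalue W n := by
  rcases Set.eq_empty_or_nonempty {μ : ℝ | ∃ (v : Fin n → E) (c : Fin n → ℝ), Orthonormal 𝕜 v ∧
      ∀ i, W (v i) = (c i : 𝕜) • v i ∧ μ ≤ c i} with h | ⟨μ, v, c, hv, h⟩
  · rw [orderedEigenvalue, h, Real.sSup_empty]
  · refine le_csSup (bddAbove_orderedEigenvalue hW hn) ⟨v, c, hv, fun i => ⟨(h i).1, ?_⟩⟩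
    have h3 := mul_norm_sq_of_gram_eq hW (h i).1
    rw [hv.1, one_pow, mul_one] at h3
    rw [← h3]
    positivity

theorem orderedEigenvalue_anti (hW : W = ContinuousLinearMap.adjoint S ∘L S) {n k : ℕ}
    (hn : 1 ≤ n) (hnk : n ≤ k) : orderedEigenvalue W k ≤ orderedEigenvalue W n := by
  rcases Set.eq_empty_or_nonempty {μ : ℝ | ∃ (v : Fin k → E) (c : Fin k → ℝ), Orthonormal 𝕜 v ∧
      ∀ i, W (v i) = (c i : 𝕜) • v i ∧ μ ≤ c i} with h | h
  · rw [orderedEigenvalue, h, Real.sSup_empty]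
    exact orderedEigenvalue_nonneg hW hn
  · refine csSup_le_csSup (bddAbove_orderedEigenvalue hW hn) h ?_
    rintro μ ⟨v, c, hv, h⟩
    exact ⟨v ∘ Fin.castLE hnk, c ∘ Fin.castLE hnk, hv.comp _ (Fin.castLE_injective hnk),
      fun i => h _⟩

omit [CompleteSpace E] in
theorem exists_orthonormal_of_lt_orderedEigenvalue {n : ℕ} {τ : ℝ} (hτ : 0 ≤ τ)
    (h : τ < orderedEigenvalue W n) :
    ∃ (v : Fin n → E) (c : Fin n → ℝ), Orthonormal 𝕜 v ∧
      ∀ i, W (v i) = (c i : 𝕜) • v i ∧ τ < c i := by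
  have hne : {μ : ℝ | ∃ (v : Fin n → E) (c : Fin n → ℝ), Orthonormal 𝕜 v ∧
      ∀ i, W (v i) = (c i : 𝕜) • v i ∧ μ ≤ c i}.Nonempty := by
    by_contra hne
    rw [Set.not_nonempty_iff_eq_empty] at hne
    rw [orderedEigenvalue, hne, Real.sSup_empty] at h
    exact absurd h (not_lt.2 hτ)
  obtain ⟨μ, ⟨v, c, hv, hc⟩, hμ⟩ := exists_lt_of_lt_csSup hne h
  exact ⟨v, c, hv, fun i => ⟨(hc i).1, hμ.trans_le (hc i).2⟩⟩

/-- The part of the singular value decomposition of `S` above the threshold `τ`: orthonormal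
eigenvectors of `W = S* S` for exactly those ordered eigenvalues that exceed `τ`, such that
`‖S x‖² ≤ τ ‖x‖²` on their orthogonal complement. -/
theorem exists_truncated_diagonalization (hS : IsCompactOperator S)
    (hW : W = ContinuousLinearMap.adjoint S ∘L S) {τ : ℝ} (hτ : 0 < τ) :
    ∃ (N : ℕ) (e : Fin N → E), Orthonormal 𝕜 e ∧
      (∀ j, W (e j) = (orderedEigenvalue W (j + 1) : 𝕜) • e j) ∧
      (∀ j, τ < orderedEigenvalue W (j + 1) ↔ j < N) ∧
      ∀ x, (∀ j, inner 𝕜 (e j) x = 0) → ‖S x‖ ^ 2 ≤ τ * ‖x‖ ^ 2 := by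
  set V := spectralSubspace W τ with hV
  have hfin : FiniteDimensional 𝕜 V := finiteDimensional_spectralSubspace hS hW hτ
  have hsymm := isSymmetric_gram hW
  have hinv : ∀ v ∈ V, W.toLinearMap v ∈ V := by
    intro v hv
    refine Submodule.iSup_induction (p := fun μ : {μ : 𝕜 // τ < RCLike.re μ} =>
      eigenspace W.toLinearMap (μ : 𝕜)) (motive := fun v => W.toLinearMap v ∈ V) hv ?_ ?_ ?_
    · intro μ x hx
      rw [mem_eigenspace_iff.1 hx]
      exact V.smul_mem _ (Submodule.mem_iSup_of_mem μ hx)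
    · simp
    · intro x y hx hy
      rw [map_add]
      exact V.add_mem hx hy
  have hsymm' := hsymm.restrict_invariant hinv
  let N := Module.finrank 𝕜 V
  let b := hsymm'.eigenvectorBasis (n := N) rfl
  let c := hsymm'.eigenvalues (n := N) rfl
  let e : Fin N → E := fun j => (b j : E)
  have he : Orthonormal 𝕜 e := b.orthonormal.comp_linearIsometry V.subtypeₗᵢ
  have hWe : ∀ j, W (e j) = (c j : 𝕜) • e j := by
    intro j
    have := congrArg Subtype.val (hsymm'.apply_eigenvectorBasis (n := N) rfl j)
    exact this
  have hcanti : Antitone c := hsymm'.eigenvalues_antitone rfl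
  have hnorm : ∀ j, ‖e j‖ = 1 := he.1
  -- An eigenvector in `V` for an eigenvalue `≤ τ` is orthogonal to all generators of `V`.
  have hcτ : ∀ j, τ < c j := by
    intro j
    by_contra hle
    push Not at hle
    have hort : e j ∈ Vᗮ := by
      rw [Submodule.mem_orthogonal]
      intro v hv
      refine Submodule.iSup_induction (p := fun μ : {μ : 𝕜 // τ < RCLike.re μ} =>
        eigenspace W.toLinearMap (μ : 𝕜)) (motive := fun v => inner 𝕜 v (e j) = 0) hv ?_ ?_ ?_
      · intro μ x hx
        have hne : (μ : 𝕜) ≠ (c j : 𝕜) := fun h => by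
          have h1 := μ.2
          rw [h, RCLike.ofReal_re] at h1
          exact absurd h1 (not_lt.2 hle)
        exact hsymm.orthogonalFamily_eigenspaces hne ⟨x, hx⟩
          ⟨e j, mem_eigenspace_iff.2 (hWe j)⟩
      · simp
      · intro x y hx hy
        rw [inner_add_left, hx, hy, add_zero]
    have h0 : inner 𝕜 (e j) (e j) = 0 := Submodule.inner_right_of_mem_orthogonal (b j).2 hort
    have := hnorm j
    rw [inner_self_eq_zero.1 h0] at this
    simp at this
  -- Dimension count: at most `j` orthonormal eigenvectors have eigenvalues above `τ` and above all
  -- `c l` with `l ≥ j`.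
  have hmemV : ∀ {n : ℕ} {v : Fin n → E} {c' : Fin n → ℝ}, Orthonormal 𝕜 v →
      (∀ i, W (v i) = (c' i : 𝕜) • v i ∧ τ < c' i) → ∀ j ≤ N, (∀ l : Fin N, j ≤ l →
        ∀ i, c l < c' i) → n ≤ j := by
    intro n v c' hv hc' j hj hlt
    -- The `v i` lie in the span of the first `j` of the vectors `e`.
    let e' : Fin j → E := fun l => e (Fin.castLE hj l)
    have hspan : ∀ i, v i ∈ Submodule.span 𝕜 (Set.range e') := by
      intro i
      have hvV : v i ∈ V := mem_spectralSubspace (hc' i).2 (hc' i).1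
      have hsum := b.sum_repr' ⟨v i, hvV⟩
      have hsum' : v i = ∑ l, inner 𝕜 (e l) (v i) • e l := by
        have := congrArg Subtype.val hsum
        rw [Submodule.coe_sum] at this
        exact this.symm
      rw [hsum']
      refine Submodule.sum_mem _ fun l _ => ?_
      rcases lt_or_ge (l : ℕ) j with h | h
      · exact Submodule.smul_mem _ _ (Submodule.subset_span ⟨⟨l, h⟩, rfl⟩)
      · have hne : (c l : 𝕜) ≠ (c' i : 𝕜) := fun h' =>
          (hlt l h i).ne (RCLike.ofReal_injective h')
        have : inner 𝕜 (e l) (v i) = 0 := hsymm.orthogonalFamily_eigenspaces hne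
          ⟨e l, mem_eigenspace_iff.2 (hWe l)⟩ ⟨v i, mem_eigenspace_iff.2 (hc' i).1⟩
        rw [this, zero_smul]
        exact Submodule.zero_mem _
    have hli : LinearIndependent 𝕜 (fun i => (⟨v i, hspan i⟩ :
        Submodule.span 𝕜 (Set.range e'))) :=
      LinearIndependent.of_comp (Submodule.subtype _) hv.linearIndependent
    have : FiniteDimensional 𝕜 (Submodule.span 𝕜 (Set.range e')) :=
      FiniteDimensional.span_of_finite 𝕜 (Set.finite_range e')
    have h1 := hli.fintype_card_le_finrank
    have h2 := finrank_range_le_card (R := 𝕜) e'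
    rw [Fintype.card_fin] at h1 h2
    exact h1.trans h2
  have hval : ∀ j : Fin N, orderedEigenvalue W (j + 1) = c j := by
    intro j
    refine le_antisymm ?_ ?_
    · by_contra hlt
      push Not at hlt
      obtain ⟨v, c', hv, hc'⟩ :=
        exists_orthonormal_of_lt_orderedEigenvalue (hτ.le.trans (hcτ j).le) hlt
      have := hmemV hv (fun i => ⟨(hc' i).1, (hcτ j).trans (hc' i).2⟩) j j.2.le fun l hl i =>
        (hcanti (Fin.le_def.2 hl)).trans_lt (hc' i).2
      omega
    · refine le_csSup (bddAbove_orderedEigenvalue hW (by omega))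
        ⟨fun i => e (Fin.castLE j.2 i), fun i => c (Fin.castLE j.2 i),
          he.comp _ (Fin.castLE_injective _), fun i => ⟨hWe _, hcanti ?_⟩⟩
      rw [Fin.le_def]
      exact Nat.lt_succ_iff.1 i.2
  refine ⟨N, e, he, fun j => by rw [hval]; exact hWe j, fun j => ⟨fun h => ?_, fun h => ?_⟩,
    fun x hx => ?_⟩
  · obtain ⟨v, c', hv, hc'⟩ := exists_orthonormal_of_lt_orderedEigenvalue hτ.le h
    exact hmemV hv hc' N le_rfl fun l hl => absurd l.2 (not_lt.2 hl)
  · rw [hval ⟨j, h⟩]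
    exact hcτ _
  · refine norm_sq_le_of_mem_spectralSubspace_orthogonal hS hW ?_
    rw [Submodule.mem_orthogonal]
    intro v hv
    have hsum := congrArg Subtype.val (b.sum_repr' ⟨v, hv⟩)
    rw [Submodule.coe_sum] at hsum
    change _ = v at hsum
    rw [← hsum, sum_inner]
    refine Finset.sum_eq_zero fun l _ => ?_
    change inner 𝕜 (_ • e l) x = 0
    rw [inner_smul_left, hx, mul_zero]

theorem tendsto_orderedEigenvalue (hS : IsCompactOperator S)
    (hW : W = ContinuousLinearMap.adjoint S ∘L S) :
    Tendsto (fun j => orderedEigenvalue W (j + 1)) atTop (𝓝 0) := by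
  rw [Metric.tendsto_atTop]
  intro τ hτ
  obtain ⟨N, -, -, -, h, -⟩ := exists_truncated_diagonalization hS hW (half_pos hτ)
  refine ⟨N, fun j hj => ?_⟩
  rw [Real.dist_eq, sub_zero, abs_of_nonneg (orderedEigenvalue_nonneg hW (by omega))]
  have := mt (h j).1 (not_lt.2 hj)
  linarith

/-- The multiplicity of the largest eigenvalue counts the ordered eigenvalues equal to it. -/
theorem orderedEigenvalue_eq_first_iff (hS : IsCompactOperator S)
    (hW : W = ContinuousLinearMap.adjoint S ∘L S) (hpos : 0 < orderedEigenvalue W 1) (j : ℕ) :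
    orderedEigenvalue W (j + 1) = orderedEigenvalue W 1 ↔
      j < Module.finrank 𝕜 (eigenspace W.toLinearMap (orderedEigenvalue W 1 : 𝕜)) := by
  set l : ℕ → ℝ := fun j => orderedEigenvalue W (j + 1) with hl
  have hanti : Antitone l := fun i j hij => orderedEigenvalue_anti hW (by omega) (by omega)
  obtain ⟨N, e, he, hWe, hN, hrest⟩ := exists_truncated_diagonalization hS hW (half_pos hpos)
  have hex : ∃ j, l j ≠ l 0 := ⟨N, fun h => absurd ((hN N).1 (by
    change _ < l N
    rw [h]
    exact half_lt_self hpos)) (lt_irrefl _)⟩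
  classical
  -- The values equal to the largest one are those before the first index `k` where it is left.
  set k := Nat.find hex with hk
  have hkeq : ∀ i, l i = l 0 ↔ i < k := fun i => by
    refine ⟨fun h => ?_, fun h => not_not.1 (Nat.find_min hex h)⟩
    by_contra hki
    push Not at hki
    exact Nat.find_spec hex (le_antisymm (hanti (Nat.zero_le _)) (h.symm.le.trans (hanti hki)))
  have hkN : k ≤ N := Nat.find_min' hex fun h => absurd ((hN N).1 (by
    change _ < l N
    rw [h]
    exact half_lt_self hpos)) (lt_irrefl _)
  let e' : Fin k → E := e ∘ Fin.castLE hkN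
  have he' : Orthonormal 𝕜 e' := he.comp _ (Fin.castLE_injective hkN)
  have hmem : ∀ i, e' i ∈ eigenspace W.toLinearMap (l 0 : 𝕜) := fun i => by
    rw [mem_eigenspace_iff, ← (hkeq i).2 i.2]
    exact hWe (Fin.castLE hkN i)
  have hspan : eigenspace W.toLinearMap (l 0 : 𝕜) = Submodule.span 𝕜 (Set.range e') := by
    refine le_antisymm (fun x hx => ?_) (Submodule.span_le.2 ?_)
    · set p := ∑ i, inner 𝕜 (e' i) x • e' i with hp
      have hpm : p ∈ Submodule.span 𝕜 (Set.range e') :=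
        Submodule.sum_mem _ fun i _ => Submodule.smul_mem _ _ (Submodule.subset_span ⟨i, rfl⟩)
      have hpE : p ∈ eigenspace W.toLinearMap (l 0 : 𝕜) :=
        Submodule.sum_mem _ fun i _ => Submodule.smul_mem _ _ (hmem i)
      have hy : x - p ∈ eigenspace W.toLinearMap (l 0 : 𝕜) := Submodule.sub_mem _ hx hpE
      have hyort : ∀ i, inner 𝕜 (e i) (x - p) = 0 := by
        intro i
        by_cases hi : (i : ℕ) < k
        · have h1 : e i = e' ⟨i, hi⟩ := rfl
          rw [inner_sub_right, h1, hp, he'.inner_right_fintype, sub_self]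
        · have hne : (l i : 𝕜) ≠ (l 0 : 𝕜) := fun h =>
            hi ((hkeq i).1 (RCLike.ofReal_injective h))
          exact (isSymmetric_gram hW).orthogonalFamily_eigenspaces hne
            ⟨e i, mem_eigenspace_iff.2 (hWe i)⟩ ⟨x - p, hy⟩
      have h1 := hrest _ hyort
      rw [mul_norm_sq_of_gram_eq hW (mem_eigenspace_iff.1 hy)] at h1
      have h0 : ‖x - p‖ ^ 2 ≤ 0 := by
        have h2 : 0 ≤ ‖x - p‖ ^ 2 := sq_nonneg _
        change orderedEigenvalue W 1 * _ ≤ _ at h1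
        nlinarith
      have h3 : x - p = 0 := by
        rw [← norm_eq_zero]
        exact pow_eq_zero_iff (two_ne_zero) |>.1 (le_antisymm h0 (sq_nonneg _))
      rwa [sub_eq_zero.1 h3]
    · rintro _ ⟨i, rfl⟩
      exact hmem i
  have hfr : Module.finrank 𝕜 (eigenspace W.toLinearMap (l 0 : 𝕜)) = k := by
    rw [hspan, finrank_span_eq_card he'.linearIndependent, Fintype.card_fin]
  change l j = l 0 ↔ j < Module.finrank 𝕜 (eigenspace W.toLinearMap (l 0 : 𝕜))
  rw [hfr, hkeq]

end Spectral

/-! ### Minimal errors and orthogonal singular directions -/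

section Complexity

variable {𝕜 E F : Type*} [RCLike 𝕜] [NormedAddCommGroup E] [InnerProductSpace 𝕜 E]
  [NormedAddCommGroup F] [InnerProductSpace 𝕜 F]

theorem norm_sq_sum_smul_of_inner {ι : Type*} [Fintype ι] [DecidableEq ι] {w : ι → E} {μ : ι → ℝ}
    (hw : ∀ p q, inner 𝕜 (w p) (w q) = if p = q then (μ p : 𝕜) else 0) (c : ι → 𝕜) :
    ‖∑ p, c p • w p‖ ^ 2 = ∑ p, ‖c p‖ ^ 2 * μ p := by
  rw [← inner_self_eq_norm_sq (𝕜 := 𝕜), sum_inner, map_sum]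
  refine Finset.sum_congr rfl fun p _ => ?_
  rw [inner_sum, Finset.sum_eq_single p]
  · rw [inner_smul_left, inner_smul_right, hw, if_pos rfl, ← mul_assoc, RCLike.conj_mul,
      ← RCLike.ofReal_pow, ← RCLike.ofReal_mul, RCLike.ofReal_re]
  · intro q _ hq
    rw [inner_smul_left, inner_smul_right, hw, if_neg (Ne.symm hq), mul_zero, mul_zero]
  · simp

theorem bddAbove_linearAlgorithm_error (T : E →L[𝕜] F) {n : ℕ} (L : Fin n → (E →L[𝕜] 𝕜))
    (φ : (Fin n → 𝕜) →ₗ[𝕜] F) :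
    BddAbove (Set.range fun f : Metric.closedBall (0 : E) 1 => ‖T f - linearAlgorithm L φ f‖) := by
  let A : E →L[𝕜] F := (LinearMap.toContinuousLinearMap φ) ∘L (ContinuousLinearMap.pi L)
  refine ⟨‖T - A‖, ?_⟩
  rintro _ ⟨f, rfl⟩
  have h1 : T f - linearAlgorithm L φ f = (T - A) f := rfl
  have h2 := (T - A).le_opNorm f
  have h3 : ‖(f : E)‖ ≤ 1 := mem_closedBall_zero_iff.1 f.2
  dsimp only
  rw [h1]
  exact h2.trans (mul_le_of_le_one_right (norm_nonneg _) h3)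

theorem worstCaseError_nonneg (T A : E → F) : 0 ≤ worstCaseError T A :=
  Real.iSup_nonneg fun _ => norm_nonneg _

theorem minimalError_le {T : E →L[𝕜] F} {n : ℕ} {κ : ℝ} (L : Fin n → (E →L[𝕜] 𝕜))
    (φ : (Fin n → 𝕜) →ₗ[𝕜] F) (hκ : 0 ≤ κ) (h : ∀ f, ‖T f - linearAlgorithm L φ f‖ ≤ κ * ‖f‖) :
    minimalError T n ≤ κ := by
  refine (ciInf_le (f := fun A : (Fin n → (E →L[𝕜] 𝕜)) × ((Fin n → 𝕜) →ₗ[𝕜] F) =>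
    worstCaseError T (linearAlgorithm A.1 A.2))
    ⟨0, by rintro _ ⟨A, rfl⟩; exact worstCaseError_nonneg _ _⟩ (L, φ)).trans ?_
  have : Nonempty (Metric.closedBall (0 : E) 1) := ⟨⟨0, by simp⟩⟩
  refine ciSup_le fun f => (h f).trans (mul_le_of_le_one_right hκ (mem_closedBall_zero_iff.1 f.2))

/-- Fewer functionals than singular directions: some unit vector in the span of the directions
is mapped to `0` by all functionals, and no linear algorithm separates it from `0`. -/
theorem le_minimalError_of_orthogonal {T : E →L[𝕜] F} {ι : Type*} [Fintype ι] [DecidableEq ι]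
    {v : ι → E} (hv : Orthonormal 𝕜 v) {μ : ι → ℝ}
    (hT : ∀ p q, inner 𝕜 (T (v p)) (T (v q)) = if p = q then (μ p : 𝕜) else 0)
    {κ : ℝ} (hμ : ∀ p, κ ^ 2 ≤ μ p) {n : ℕ} (hn : n < Fintype.card ι) :
    κ ≤ minimalError T n := by
  refine le_ciInf fun ⟨L, φ⟩ => ?_
  let R : (ι → 𝕜) →ₗ[𝕜] (Fin n → 𝕜) :=
    (LinearMap.pi fun i => (L i).toLinearMap) ∘ₗ Fintype.linearCombination 𝕜 v
  obtain ⟨c, hcR, hc0⟩ := (Submodule.ne_bot_iff _).1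
    (LinearMap.ker_ne_bot_of_finrank_lt (f := R) (by simpa using hn))
  set f := ∑ p, c p • v p with hf
  have hL : (fun i => L i f) = 0 := by
    have : R c = 0 := hcR
    rw [← this]
    ext i
    simp [R, hf, Fintype.linearCombination_apply]
  have h1 : ‖f‖ ^ 2 = ∑ p, ‖c p‖ ^ 2 * 1 :=
    norm_sq_sum_smul_of_inner (fun p q => by
      rw [orthonormal_iff_ite.1 hv]; simp) c
  have h2 : ‖T f‖ ^ 2 = ∑ p, ‖c p‖ ^ 2 * μ p := by
    rw [hf, map_sum]
    simp only [map_smul]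
    exact norm_sq_sum_smul_of_inner hT c
  have hfne : f ≠ 0 := by
    intro h0
    apply hc0
    ext p
    have := hv.inner_right_fintype c p
    rw [← hf, h0, inner_zero_right] at this
    exact this.symm
  have hfpos : 0 < ‖f‖ := norm_pos_iff.2 hfne
  have h3 : κ * ‖f‖ ≤ ‖T f‖ := by
    refine le_of_sq_le_sq ?_ (norm_nonneg _)
    rw [mul_pow, h1, h2, Finset.mul_sum]
    refine Finset.sum_le_sum fun p _ => ?_
    rw [mul_one, mul_comm]
    exact mul_le_mul_of_nonneg_left (hμ p) (sq_nonneg _)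
  let g : E := ((‖f‖⁻¹ : ℝ) : 𝕜) • f
  have hg : ‖g‖ = 1 := by
    rw [norm_smul, RCLike.norm_ofReal, abs_of_nonneg (by positivity),
      inv_mul_cancel₀ hfpos.ne']
  have hgL : linearAlgorithm L φ g = 0 := by
    have : (fun i => L i g) = 0 := by
      funext i
      have := congrFun hL i
      simp only [Pi.zero_apply] at this
      simp [g, this]
    rw [linearAlgorithm, this, map_zero]
  have h4 : κ ≤ ‖T g - linearAlgorithm L φ g‖ := by
    rw [hgL, sub_zero, map_smul, norm_smul, RCLike.norm_ofReal, abs_of_nonneg (by positivity),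
      ← div_eq_inv_mul, le_div_iff₀ hfpos]
    exact h3
  exact h4.trans (le_ciSup (bddAbove_linearAlgorithm_error T L φ)
    (⟨g, by simp [hg]⟩ : Metric.closedBall (0 : E) 1))

/-- The projection onto the span of `v`, followed by `T`, is a linear algorithm. -/
theorem minimalError_card_le {T : E →L[𝕜] F} {ι : Type*} [Fintype ι] {v : ι → E} {κ : ℝ}
    (hκ : 0 ≤ κ) (h : ∀ f, ‖T (f - ∑ p, inner 𝕜 (v p) f • v p)‖ ≤ κ * ‖f‖) :
    minimalError T (Fintype.card ι) ≤ κ := by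
  let σ := Fintype.equivFin ι
  refine minimalError_le (fun i => innerSL 𝕜 (v (σ.symm i)))
    (Fintype.linearCombination 𝕜 fun i => T (v (σ.symm i))) hκ fun f => ?_
  have h1 : linearAlgorithm (fun i => innerSL 𝕜 (v (σ.symm i)))
      (Fintype.linearCombination 𝕜 fun i => T (v (σ.symm i))) f =
      T (∑ p, inner 𝕜 (v p) f • v p) := by
    rw [map_sum, ← σ.symm.sum_comp]
    simp [linearAlgorithm, Fintype.linearCombination_apply]
  rw [h1, ← map_sub]
  exact h f

variable [CompleteSpace E] [CompleteSpace F] {S : E →L[𝕜] F} {W : E →L[𝕜] E}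

/-- A finite-dimensional subspace containing some of the eigenvectors of `W = S* S` has an
orthonormal basis extending these eigenvectors whose image under `S` is orthogonal. -/
theorem exists_basis_extending_eigenvectors (hW : W = ContinuousLinearMap.adjoint S ∘L S)
    {N : ℕ} {e : Fin N → E} (he : Orthonormal 𝕜 e) {l : Fin N → ℝ}
    (hWe : ∀ j, W (e j) = (l j : 𝕜) • e j) {τ : ℝ}
    (hτ : ∀ x, (∀ j, inner 𝕜 (e j) x = 0) → ‖S x‖ ^ 2 ≤ τ * ‖x‖ ^ 2)
    (U : Submodule 𝕜 E) [FiniteDimensional 𝕜 U] (heU : ∀ j, e j ∈ U) :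
    ∃ (r : ℕ) (b : Module.Basis (Fin N ⊕ Fin r) 𝕜 U) (μ : Fin N ⊕ Fin r → ℝ),
      (∀ j, (b (Sum.inl j) : E) = e j) ∧
      (∀ i j, inner 𝕜 (b i : E) (b j : E) = if i = j then ((1 : ℝ) : 𝕜) else 0) ∧
      (∀ i j, inner 𝕜 (S (b i)) (S (b j)) = if i = j then (μ i : 𝕜) else 0) ∧
      (∀ j, μ (Sum.inl j) = l j) ∧ (∀ i, 0 ≤ μ i) ∧ ∀ i, μ (Sum.inr i) ≤ τ := by
  -- Diagonalize `S* S` on the part of `U` orthogonal to the given eigenvectors; cross terms vanish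
  -- because `⟪S x, S e_j⟫ = l j ⟪x, e_j⟫`.
  let K : Submodule 𝕜 E := U ⊓ (Submodule.span 𝕜 (Set.range e))ᗮ
  have hKU : K ≤ U := inf_le_left
  have hKe : ∀ x ∈ K, ∀ j, inner 𝕜 (e j) x = 0 := fun x hx j =>
    Submodule.inner_right_of_mem_orthogonal (Submodule.subset_span (Set.mem_range_self j)) hx.2
  have : FiniteDimensional 𝕜 K := Submodule.finiteDimensional_of_le hKU
  let A : K →L[𝕜] F := S ∘L K.subtypeL
  have hA : (ContinuousLinearMap.adjoint A ∘L A).toLinearMap.IsSymmetric := isSymmetric_gram rfl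
  set r := Module.finrank 𝕜 K with hr
  let b' := hA.eigenvectorBasis hr.symm
  let μ' := hA.eigenvalues hr.symm
  have hb' : ∀ i j, inner 𝕜 (S (b' i)) (S (b' j)) = if i = j then (μ' i : 𝕜) else 0 := by
    intro i j
    have h1 : inner 𝕜 (b' i) ((ContinuousLinearMap.adjoint A ∘L A) (b' j)) =
      inner 𝕜 (S (b' i)) (S (b' j)) := inner_gram rfl _ _
    have h2 : (ContinuousLinearMap.adjoint A ∘L A) (b' j) = (μ' j : 𝕜) • b' j :=
      hA.apply_eigenvectorBasis hr.symm j
    rw [← h1, h2, inner_smul_right, b'.inner_eq_ite]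
    split_ifs with h
    · rw [h, mul_one]
    · rw [mul_zero]
  let w : Fin N ⊕ Fin r → E := Sum.elim e fun i => b' i
  have hwU : ∀ i, w i ∈ U := by
    rintro (j | i)
    · exact heU j
    · exact hKU (b' i).2
  have hw : Orthonormal 𝕜 w := by
    rw [orthonormal_iff_ite]
    rintro (i | i) (j | j)
    · simpa [w] using orthonormal_iff_ite.1 he i j
    · simpa [w] using hKe _ (b' j).2 i
    · have := hKe _ (b' i).2 j
      rw [← inner_conj_symm, map_eq_zero] at this
      simpa [w] using this
    · have := b'.inner_eq_ite i j
      simpa [w] using this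
  let w' : Fin N ⊕ Fin r → U := fun i => ⟨w i, hwU i⟩
  have hli : LinearIndependent 𝕜 w' :=
    LinearIndependent.of_comp U.subtype hw.linearIndependent
  have hsp : ⊤ ≤ Submodule.span 𝕜 (Set.range w') := by
    rintro ⟨x, hx⟩ -
    set p := ∑ j, inner 𝕜 (e j) x • e j with hp
    have hpU : p ∈ U := Submodule.sum_mem _ fun j _ => U.smul_mem _ (heU j)
    have hxp : x - p ∈ K := by
      refine ⟨U.sub_mem hx hpU, (Submodule.mem_orthogonal _ _).2 ?_⟩
      intro y hy
      induction hy using Submodule.span_induction with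
      | mem y hy =>
        obtain ⟨j, rfl⟩ := hy
        rw [inner_sub_right, hp, he.inner_right_fintype, sub_self]
      | zero => simp
      | add y z _ _ hy hz => rw [inner_add_left, hy, hz, add_zero]
      | smul c y _ hy => rw [inner_smul_left, hy, mul_zero]
    have h1 := congrArg (fun y : K => (y : E)) (b'.sum_repr ⟨x - p, hxp⟩)
    have h2 : (⟨x, hx⟩ : U) = ∑ j, inner 𝕜 (e j) x • w' (Sum.inl j) +
        ∑ i, b'.repr ⟨x - p, hxp⟩ i • w' (Sum.inr i) := by
      apply Subtype.ext
      simp only [Submodule.coe_sum, Submodule.coe_smul] at h1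
      simp only [Submodule.coe_add, Submodule.coe_sum, Submodule.coe_smul]
      change x = p + ∑ i, b'.repr ⟨x - p, hxp⟩ i • (b' i : E)
      rw [h1]
      abel
    rw [h2]
    exact Submodule.add_mem _
      (Submodule.sum_mem _ fun j _ => Submodule.smul_mem _ _ (Submodule.subset_span ⟨_, rfl⟩))
      (Submodule.sum_mem _ fun j _ => Submodule.smul_mem _ _ (Submodule.subset_span ⟨_, rfl⟩))
  let b := Module.Basis.mk hli hsp
  have hb : ∀ i, (b i : E) = w i := fun i => by
    simp [b, w']
  let μ : Fin N ⊕ Fin r → ℝ := Sum.elim l μ'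
  have hSe : ∀ j x, inner 𝕜 (S x) (S (e j)) = (l j : 𝕜) * inner 𝕜 x (e j) := fun j x => by
    rw [← inner_gram hW, hWe, inner_smul_right]
  have hSb : ∀ i j, inner 𝕜 (S (b i)) (S (b j)) = if i = j then (μ i : 𝕜) else 0 := by
    intro i j
    rw [hb, hb]
    have hwij := orthonormal_iff_ite.1 hw i j
    have hwji := orthonormal_iff_ite.1 hw j i
    rcases j with j | j
    · change inner 𝕜 _ (S (e j)) = _
      rw [hSe]
      change _ * inner 𝕜 (w i) (w (Sum.inl j)) = _
      rw [hwij]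
      split_ifs with h
      · rw [h, mul_one]; rfl
      · rw [mul_zero]
    · rcases i with i | i
      · change inner 𝕜 (S (e i)) _ = _
        rw [← inner_conj_symm, hSe]
        change (starRingEnd 𝕜) (_ * inner 𝕜 (w (Sum.inr j)) (w (Sum.inl i))) = _
        rw [hwji]
        simp
      · have := hb' i j
        simpa [w, μ] using this
  have hμ : ∀ i, μ i = ‖S (b i)‖ ^ 2 := by
    intro i
    have := hSb i i
    rw [if_pos rfl, inner_self_eq_norm_sq_to_K] at this
    exact_mod_cast this.symm
  refine ⟨r, b, μ, fun j => hb _, fun i j => ?_, hSb, fun j => rfl, fun i => ?_, fun i => ?_⟩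
  · rw [hb, hb, orthonormal_iff_ite.1 hw]
    simp
  · rw [hμ]; positivity
  · rw [hμ, hb]
    have h1 := hτ (w (Sum.inr i)) (hKe _ (b' i).2)
    rwa [hw.1, one_pow, mul_one] at h1

end Complexity

/-! ### Singular values of tensor powers -/

section TensorPower

variable {𝕜 E F : Type*} [RCLike 𝕜] [NormedAddCommGroup E] [InnerProductSpace 𝕜 E]
  [NormedAddCommGroup F] [InnerProductSpace 𝕜 F] {d : ℕ}

theorem AlgTensorPower.map_map {D : Type*} [NormedAddCommGroup D] [InnerProductSpace 𝕜 D]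
    (T : E →ₗ[𝕜] F) (R : D →ₗ[𝕜] E) (z : AlgTensorPower 𝕜 D d) :
    map T (map R z) = map (T ∘ₗ R) z := by
  induction z using AlgTensorPower.induction with
  | smul c x => simp only [LinearMap.map_smul, map_tprod]; rfl
  | add z w hz hw => simp only [_root_.map_add, hz, hw]

theorem AlgTensorPower.exists_finiteDimensional_ge (z : AlgTensorPower 𝕜 E d)
    (V : Submodule 𝕜 E) [FiniteDimensional 𝕜 V] :
    ∃ U : Submodule 𝕜 E, FiniteDimensional 𝕜 U ∧ V ≤ U ∧
      ∃ z' : AlgTensorPower 𝕜 U d, map U.subtype z' = z := by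
  obtain ⟨U, hU, z', rfl⟩ := exists_finiteDimensional z
  exact ⟨U ⊔ V, inferInstance, le_sup_right, map (Submodule.inclusion le_sup_left) z', by
    rw [map_map]; rfl⟩

variable [CompleteSpace E] [CompleteSpace F] {S : E →L[𝕜] F} {W : E →L[𝕜] E}

/-- The truncation error of the singular value decomposition of `S ⊗ ⋯ ⊗ S` on the algebraic
tensor power. All singular values that are not retained are at most `κ`: those with a factor
outside the truncated diagonalization of `S` because of `τ L^(d-1) ≤ κ²`. -/
theorem norm_mapL_sub_truncation_le (hW : W = ContinuousLinearMap.adjoint S ∘L S)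
    {N : ℕ} {e : Fin N → E} (he : Orthonormal 𝕜 e) {l : Fin N → ℝ}
    (hWe : ∀ j, W (e j) = (l j : 𝕜) • e j) {τ L κ : ℝ}
    (hτ : ∀ x, (∀ j, inner 𝕜 (e j) x = 0) → ‖S x‖ ^ 2 ≤ τ * ‖x‖ ^ 2)
    (hlL : ∀ j, l j ≤ L) (hτL : τ ≤ L) (hκ : 0 ≤ κ) (hτκ : τ * L ^ (d - 1) ≤ κ ^ 2)
    (P : Finset (Fin d → Fin N)) (hP : ∀ p ∉ P, ∏ i, l (p i) ≤ κ ^ 2)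
    (z : AlgTensorPower 𝕜 E d) :
    ‖AlgTensorPower.mapL S (z - ∑ p ∈ P,
      inner 𝕜 (AlgTensorPower.tprod (𝕜 := 𝕜) fun i => e (p i)) z •
        AlgTensorPower.tprod (𝕜 := 𝕜) fun i => e (p i))‖ ≤ κ * ‖z‖ := by
  classical
  have : FiniteDimensional 𝕜 (Submodule.span 𝕜 (Set.range e)) :=
    FiniteDimensional.span_of_finite 𝕜 (Set.finite_range e)
  obtain ⟨U, hU, hUe, z, rfl⟩ :=
    AlgTensorPower.exists_finiteDimensional_ge z (Submodule.span 𝕜 (Set.range e))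
  obtain ⟨r, b, μ, hbe, hbb, hSb, hμl, hμ0, hμτ⟩ := exists_basis_extending_eigenvectors hW he hWe hτ
    U fun j => hUe (Submodule.subset_span ⟨j, rfl⟩)
  let B : Module.Basis (Fin d → Fin N ⊕ Fin r) 𝕜 (AlgTensorPower 𝕜 U d) :=
    Basis.piTensorProduct fun _ : Fin d => b
  have hB : ∀ q, B q = AlgTensorPower.tprod (𝕜 := 𝕜) fun i => b (q i) := fun q =>
    Basis.piTensorProduct_apply _ _
  let c := B.repr z
  let ι : (Fin d → Fin N) → (Fin d → Fin N ⊕ Fin r) := fun p i => Sum.inl (p i)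
  have hι : Function.Injective ι := fun p q h => by
    funext i
    exact Sum.inl_injective (congrFun h i)
  have hv : ∀ p : Fin d → Fin N, AlgTensorPower.map U.subtype (B (ι p)) =
      AlgTensorPower.tprod (𝕜 := 𝕜) fun i => e (p i) := by
    intro p
    rw [hB, AlgTensorPower.map_tprod]
    congr 1
    funext i
    exact hbe (p i)
  have hcoef : ∀ p : Fin d → Fin N, inner 𝕜 (AlgTensorPower.tprod (𝕜 := 𝕜) fun i => e (p i))
      (AlgTensorPower.map U.subtype z) = c (ι p) := by
    intro p
    rw [← hv]
    conv_lhs => rw [← B.sum_repr z]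
    rw [map_sum, inner_sum, Finset.sum_eq_single (ι p)]
    · rw [LinearMap.map_smul, inner_smul_right, hB, AlgTensorPower.map_tprod,
        AlgTensorPower.inner_tprod, Finset.prod_eq_one, mul_one]
      intro i _
      exact (hbb _ _).trans (by simp)
    · intro q _ hq
      obtain ⟨i, hi⟩ := Function.ne_iff.mp hq
      rw [LinearMap.map_smul, inner_smul_right, hB, hB, AlgTensorPower.map_tprod,
        AlgTensorPower.map_tprod, AlgTensorPower.inner_tprod,
        Finset.prod_eq_zero (Finset.mem_univ i), mul_zero]
      exact (hbb _ _).trans (if_neg (Ne.symm hi))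
    · simp
  set y := z - ∑ p ∈ P, c (ι p) • B (ι p) with hy
  have hyz : AlgTensorPower.map U.subtype z -
      ∑ p ∈ P, inner 𝕜 (AlgTensorPower.tprod (𝕜 := 𝕜) fun i => e (p i))
        (AlgTensorPower.map U.subtype z) • (AlgTensorPower.tprod (𝕜 := 𝕜) fun i => e (p i)) =
      AlgTensorPower.map U.subtype y := by
    rw [hy, map_sub, map_sum]
    congr 1
    refine Finset.sum_congr rfl fun p _ => ?_
    rw [hcoef, LinearMap.map_smul, hv]
  have hyrepr : ∀ q, B.repr y q = if q ∈ P.image ι then 0 else c q := by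
    intro q
    rw [hy, map_sub, map_sum, Finsupp.sub_apply, Finsupp.finsetSum_apply]
    simp only [LinearEquiv.map_smul, Module.Basis.repr_self, Finsupp.smul_apply, smul_eq_mul,
      Finsupp.single_apply, mul_ite, mul_one, mul_zero]
    split_ifs with h
    · obtain ⟨p, hp, rfl⟩ := Finset.mem_image.1 h
      simp only [hι.eq_iff]
      simp [hp, c]
    · rw [Finset.sum_eq_zero, sub_zero]
      intro p hp
      rw [if_neg]
      rintro rfl
      exact h (Finset.mem_image_of_mem _ hp)
  have hnz : ‖AlgTensorPower.map U.subtype z‖ ^ 2 = ∑ q, ‖c q‖ ^ 2 := by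
    have h1 := AlgTensorPower.inner_map_self b U.subtype (fun _ => 1) (fun i j => hbb i j) z
    rw [inner_self_eq_norm_sq_to_K, ← RCLike.ofReal_pow, RCLike.ofReal_inj] at h1
    rw [h1]
    simp only [Finset.prod_const_one, mul_one]
    rfl
  have hny : ‖AlgTensorPower.mapL S (AlgTensorPower.map U.subtype y)‖ ^ 2 =
      ∑ q, ‖B.repr y q‖ ^ 2 * ∏ i, μ (q i) := by
    have h0 : AlgTensorPower.mapL S (AlgTensorPower.map U.subtype y) =
        AlgTensorPower.map (S.toLinearMap ∘ₗ U.subtype) y := AlgTensorPower.map_map _ _ _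
    have h1 := AlgTensorPower.inner_map_self b (S.toLinearMap ∘ₗ U.subtype) μ
      (fun i j => hSb i j) y
    rw [inner_self_eq_norm_sq_to_K, ← RCLike.ofReal_pow, RCLike.ofReal_inj] at h1
    rw [h0, h1]
    rfl
  -- A tuple outside `P` either involves a basis vector that is not one of the `e j`, or consists of
  -- indices of the `e j` and is covered by `hP`.
  have hprod : ∀ q, q ∉ P.image ι → ∏ i, μ (q i) ≤ κ ^ 2 := by
    intro q hq
    by_cases h : ∃ i j, q i = Sum.inr j
    · obtain ⟨i, j, hij⟩ := h
      have hτ0 : 0 ≤ τ := (hμ0 _).trans (hμτ j)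
      have hμL : ∀ i, μ i ≤ L := by
        rintro (i | i)
        · rw [hμl]; exact hlL i
        · exact (hμτ i).trans hτL
      rw [← Finset.mul_prod_erase _ _ (Finset.mem_univ i)]
      refine le_trans (mul_le_mul (hij ▸ hμτ j) ?_ (Finset.prod_nonneg fun _ _ => hμ0 _) hτ0) hτκ
      refine (Finset.prod_le_prod (fun _ _ => hμ0 _) fun k _ => hμL (q k)).trans ?_
      simp [Finset.card_erase_of_mem]
    · push Not at h
      have h' : ∀ i, ∃ j, q i = Sum.inl j := fun i => by
        rcases hqi : q i with j | j
        · exact ⟨j, rfl⟩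
        · exact absurd hqi (h i j)
      choose p hp using h'
      have hqp : ι p = q := funext fun i => (hp i).symm
      have hpP : p ∉ P := fun hpP => hq (hqp ▸ Finset.mem_image_of_mem _ hpP)
      refine le_of_eq_of_le (Finset.prod_congr rfl fun i _ => ?_) (hP p hpP)
      rw [hp, hμl]
  rw [hyz]
  refine le_of_sq_le_sq ?_ (by positivity)
  rw [hny, mul_pow, hnz, Finset.mul_sum]
  refine Finset.sum_le_sum fun q _ => ?_
  rw [hyrepr]
  split_ifs with h
  · simp only [norm_zero, ne_eq, OfNat.ofNat_ne_zero, not_false_eq_true, zero_pow, zero_mul]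
    positivity
  · rw [mul_comm]
    exact mul_le_mul_of_nonneg_right (hprod q h) (sq_nonneg _)

/-- The elementary tensor of a family of vectors, in the Hilbert space tensor power. -/
def hilbertTprod (x : Fin d → E) : HilbertTensorPower 𝕜 E d :=
  ((AlgTensorPower.tprod (𝕜 := 𝕜) x : AlgTensorPower 𝕜 E d) : HilbertTensorPower 𝕜 E d)

omit [CompleteSpace E] in
theorem inner_hilbertTprod (x y : Fin d → E) :
    inner 𝕜 (hilbertTprod (𝕜 := 𝕜) x) (hilbertTprod (𝕜 := 𝕜) y) = ∏ i, inner 𝕜 (x i) (y i) := by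
  rw [hilbertTprod, hilbertTprod, UniformSpace.Completion.inner_coe, AlgTensorPower.inner_tprod]

omit [CompleteSpace E] in
theorem tensorProductProblem_coe (S : E →L[𝕜] F) (z : AlgTensorPower 𝕜 E d) :
    tensorProductProblem S d (z : HilbertTensorPower 𝕜 E d) =
      (AlgTensorPower.mapL S z : AlgTensorPower 𝕜 F d) :=
  ContinuousLinearMap.completion_apply_coe _ _

omit [CompleteSpace E] in
theorem tensorProductProblem_hilbertTprod (S : E →L[𝕜] F) (x : Fin d → E) :
    tensorProductProblem S d (hilbertTprod (𝕜 := 𝕜) x) =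
      hilbertTprod (𝕜 := 𝕜) fun i => S (x i) := by
  rw [hilbertTprod, tensorProductProblem_coe, hilbertTprod]
  congr 1
  exact AlgTensorPower.map_tprod _ _

/-- The bound `norm_mapL_sub_truncation_le`, extended by density to the completion. -/
theorem norm_tensorProductProblem_sub_truncation_le
    (hW : W = ContinuousLinearMap.adjoint S ∘L S)
    {N : ℕ} {e : Fin N → E} (he : Orthonormal 𝕜 e) {l : Fin N → ℝ}
    (hWe : ∀ j, W (e j) = (l j : 𝕜) • e j) {τ L κ : ℝ}
    (hτ : ∀ x, (∀ j, inner 𝕜 (e j) x = 0) → ‖S x‖ ^ 2 ≤ τ * ‖x‖ ^ 2)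
    (hlL : ∀ j, l j ≤ L) (hτL : τ ≤ L) (hκ : 0 ≤ κ) (hτκ : τ * L ^ (d - 1) ≤ κ ^ 2)
    (P : Finset (Fin d → Fin N)) (hP : ∀ p ∉ P, ∏ i, l (p i) ≤ κ ^ 2)
    (f : HilbertTensorPower 𝕜 E d) :
    ‖tensorProductProblem S d (f - ∑ p ∈ P, inner 𝕜 (hilbertTprod (𝕜 := 𝕜) fun i => e (p i)) f •
      hilbertTprod (𝕜 := 𝕜) fun i => e (p i))‖ ≤ κ * ‖f‖ := by
  induction f using UniformSpace.Completion.induction_on with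
  | hp => exact isClosed_le (by fun_prop) (by fun_prop)
  | ih z =>
    have h := norm_mapL_sub_truncation_le hW he hWe hτ hlL hτL hκ hτκ P hP z
    have h1 : (z : HilbertTensorPower 𝕜 E d) -
        ∑ p ∈ P, inner 𝕜 (hilbertTprod (𝕜 := 𝕜) fun i => e (p i)) (z : HilbertTensorPower 𝕜 E d) •
          (hilbertTprod (𝕜 := 𝕜) fun i => e (p i)) =
        ((z - ∑ p ∈ P, inner 𝕜 (AlgTensorPower.tprod (𝕜 := 𝕜) fun i => e (p i)) z •
          AlgTensorPower.tprod (𝕜 := 𝕜) fun i => e (p i) : AlgTensorPower 𝕜 E d) :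
            HilbertTensorPower 𝕜 E d) := by
      simp only [hilbertTprod, UniformSpace.Completion.inner_coe]
      simp only [← UniformSpace.Completion.coe_toComplₗᵢ (𝕜 := 𝕜), map_sub, map_sum, map_smul]
    rw [h1, tensorProductProblem_coe, UniformSpace.Completion.norm_coe,
      UniformSpace.Completion.norm_coe]
    exact h

theorem inner_tensor_eigenvectors (hW : W = ContinuousLinearMap.adjoint S ∘L S) {ι : Type*}
    [DecidableEq ι] {e : ι → E} (he : Orthonormal 𝕜 e) {l : ι → ℝ}
    (hWe : ∀ j, W (e j) = (l j : 𝕜) • e j) (p q : Fin d → ι) :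
    inner 𝕜 (tensorProductProblem S d (hilbertTprod (𝕜 := 𝕜) fun i => e (p i)))
      (tensorProductProblem S d (hilbertTprod (𝕜 := 𝕜) fun i => e (q i))) =
      if p = q then ((∏ i, l (p i) : ℝ) : 𝕜) else 0 := by
  rw [tensorProductProblem_hilbertTprod, tensorProductProblem_hilbertTprod, inner_hilbertTprod]
  have h : ∀ i, inner 𝕜 (S (e (p i))) (S (e (q i))) = if p i = q i then (l (p i) : 𝕜) else 0 := by
    intro i
    rw [← inner_gram hW, hWe, inner_smul_right, orthonormal_iff_ite.1 he]
    split_ifs with h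
    · rw [h, mul_one]
    · rw [mul_zero]
  simp only [h]
  split_ifs with hpq
  · subst hpq
    simp
  · obtain ⟨i, hi⟩ := Function.ne_iff.mp hpq
    exact Finset.prod_eq_zero (Finset.mem_univ i) (if_neg hi)

omit [CompleteSpace E] in
theorem orthonormal_hilbertTprod {ι : Type*} {e : ι → E} (he : Orthonormal 𝕜 e) :
    Orthonormal 𝕜 fun p : Fin d → ι => hilbertTprod (𝕜 := 𝕜) fun i => e (p i) := by
  classical
  rw [orthonormal_iff_ite]
  intro p q
  rw [inner_hilbertTprod]
  simp only [orthonormal_iff_ite.1 he]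
  split_ifs with hpq
  · subst hpq
    simp
  · obtain ⟨i, hi⟩ := Function.ne_iff.mp hpq
    exact Finset.prod_eq_zero (Finset.mem_univ i) (if_neg hi)

theorem minimalError_tensorProductProblem_zero (hS : IsCompactOperator S)
    (hW : W = ContinuousLinearMap.adjoint S ∘L S) (hpos : 0 < orderedEigenvalue W 1)
    (hd : 1 ≤ d) : minimalError (tensorProductProblem S d) 0 = √(orderedEigenvalue W 1) ^ d := by
  classical
  obtain ⟨N, e, he, hWe, hN, hrest⟩ := exists_truncated_diagonalization hS hW (half_pos hpos)
  have hN0 : 0 < N := (hN 0).1 (half_lt_self hpos)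
  set L := orderedEigenvalue W 1 with hL
  have hsq : (√L ^ d) ^ 2 = L ^ d := by
    rw [← pow_mul, mul_comm, pow_mul, Real.sq_sqrt hpos.le]
  have hle : ∀ j : ℕ, orderedEigenvalue W (j + 1) ≤ L := fun j =>
    orderedEigenvalue_anti hW le_rfl (by omega)
  have hprod : ∀ p : Fin d → Fin N, ∏ i, orderedEigenvalue W (p i + 1) ≤ L ^ d := fun p => by
    refine (Finset.prod_le_prod (fun _ _ => orderedEigenvalue_nonneg hW (by omega))
      fun i _ => hle (p i)).trans ?_
    simp
  refine le_antisymm ?_ ?_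
  · have h := norm_tensorProductProblem_sub_truncation_le (d := d) (κ := √L ^ d) hW he hWe hrest
      (fun j => hle j) (half_le_self hpos.le) (by positivity) (by
        rw [hsq, ← Nat.succ_pred_eq_of_pos hd, pow_succ]
        simp only [Nat.succ_eq_add_one, Nat.add_sub_cancel]
        rw [mul_comm]
        exact mul_le_mul_of_nonneg_left (half_le_self hpos.le) (by positivity))
      ∅ (fun p _ => (hprod p).trans hsq.ge)
    refine minimalError_le 0 0 (by positivity) fun f => ?_
    simpa [linearAlgorithm] using h f
  · have hT := inner_tensor_eigenvectors (d := d) hW he hWe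
    have hv := orthonormal_hilbertTprod (d := d) he
    let p0 : Fin d → Fin N := fun _ => ⟨0, hN0⟩
    refine le_minimalError_of_orthogonal (ι := Unit)
      (v := fun _ => hilbertTprod (𝕜 := 𝕜) fun i => e (p0 i)) (μ := fun _ => L ^ d)
      (hv.comp (fun _ : Unit => p0) fun _ _ _ => rfl) (fun _ _ => ?_) (fun _ => hsq.le) (by simp)
    rw [hT]
    simp [p0, ← hL]

/-- The information complexity counts the eigenvalues of `S_d* S_d`, that is, the products of `d`
eigenvalues of `S* S`, that exceed `ε²` times the largest one. -/
theorem normalizedInfoComplexity_tensorProductProblem (hS : IsCompactOperator S)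
    (hW : W = ContinuousLinearMap.adjoint S ∘L S) (hpos : 0 < orderedEigenvalue W 1)
    (hd : 1 ≤ d) {ε : ℝ} (hε : 0 < ε) (hε1 : ε < 1) :
    normalizedInfoComplexity ε (tensorProductProblem S d) =
      {p : Fin d → ℕ | ε ^ 2 * orderedEigenvalue W 1 ^ d <
        ∏ i, orderedEigenvalue W (p i + 1)}.ncard := by
  classical
  set L := orderedEigenvalue W 1 with hL
  have hεL : 0 < ε ^ 2 * L := by positivity
  have hεL' : ε ^ 2 * L ≤ L := mul_le_of_le_one_left hpos.le (by nlinarith)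
  obtain ⟨N, e, he, hWe, hN, hrest⟩ := exists_truncated_diagonalization hS hW hεL
  have hle : ∀ j : ℕ, orderedEigenvalue W (j + 1) ≤ L := fun j =>
    orderedEigenvalue_anti hW le_rfl (by omega)
  set κ := ε * √L ^ d with hκ
  have hκ0 : 0 ≤ κ := by positivity
  have hsq : κ ^ 2 = ε ^ 2 * L ^ d := by
    rw [hκ, mul_pow, ← pow_mul, mul_comm d, pow_mul, Real.sq_sqrt hpos.le]
  have hpow : ε ^ 2 * L ^ d = ε ^ 2 * L * L ^ (d - 1) := by
    rw [mul_assoc, ← pow_succ', Nat.sub_add_cancel hd]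
  let l : ℕ → ℝ := fun j => orderedEigenvalue W (j + 1)
  have hl0 : ∀ j, 0 ≤ l j := fun j => orderedEigenvalue_nonneg hW (by omega)
  let P : Finset (Fin d → Fin N) := {p | ε ^ 2 * L ^ d < ∏ i, l (p i)}
  have hPmem : ∀ p, p ∈ P ↔ κ ^ 2 < ∏ i, l (p i) := fun p => by simp [P, hsq]
  have hcard : {p : Fin d → ℕ | ε ^ 2 * L ^ d < ∏ i, orderedEigenvalue W (p i + 1)}.ncard =
      P.card := by
    have himg : {p : Fin d → ℕ | ε ^ 2 * L ^ d < ∏ i, orderedEigenvalue W (p i + 1)} =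
        (fun (p : Fin d → Fin N) i => (p i : ℕ)) '' (P : Set (Fin d → Fin N)) := by
      ext p
      rw [Set.mem_image]
      constructor
      · intro (hp : ε ^ 2 * L ^ d < ∏ i, l (p i))
        have hpN : ∀ i, p i < N := by
          intro i
          rw [← hN]
          by_contra hi
          push Not at hi
          refine absurd hp (not_lt.2 ?_)
          rw [hpow, ← Finset.mul_prod_erase _ _ (Finset.mem_univ i)]
          refine mul_le_mul hi ?_ (Finset.prod_nonneg fun _ _ => hl0 _) hεL.le
          refine (Finset.prod_le_prod (fun _ _ => hl0 _) fun k _ => hle (p k)).trans ?_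
          simp [Finset.card_erase_of_mem]
        exact ⟨fun i => ⟨p i, hpN i⟩, by simpa [P] using hp, rfl⟩
      · rintro ⟨p, hp, rfl⟩
        simpa [P] using hp
    rw [himg, Set.ncard_image_of_injective _ fun p q h => funext fun i =>
      Fin.ext (congrFun h i), Set.ncard_coe_finset]
  rw [hcard, normalizedInfoComplexity, minimalError_tensorProductProblem_zero hS hW hpos hd, ← hκ]
  have hT := inner_tensor_eigenvectors (d := d) hW he hWe
  have hv := orthonormal_hilbertTprod (d := d) he
  have hmem : P.card ∈ {n : ℕ | minimalError (tensorProductProblem S d) n ≤ κ} := by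
    have h := minimalError_card_le (T := tensorProductProblem S d) (ι := P)
      (v := fun p => hilbertTprod (𝕜 := 𝕜) fun i => e (p.1 i)) hκ0 fun f => by
        have := norm_tensorProductProblem_sub_truncation_le (κ := κ) hW he hWe hrest
          (fun j => hle j) hεL' hκ0 (by rw [hsq, hpow]) P
          (fun p hp => not_lt.1 (mt (hPmem p).2 hp)) f
        rwa [← Finset.sum_coe_sort] at this
    simpa using h
  refine le_antisymm (Nat.sInf_le hmem) (le_csInf ⟨_, hmem⟩ fun n hn => ?_)
  by_contra hlt
  push Not at hlt
  -- The least counted eigenvalue bounds all errors below uniformly, so that the strict inequality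
  -- survives the infimum over algorithms.
  obtain ⟨p0, hp0, hmin⟩ := P.exists_min_image (fun p => ∏ i, l (p i))
    (Finset.card_pos.1 (by omega))
  have hlow : √(∏ i, l (p0 i)) ≤ minimalError (tensorProductProblem S d) n := by
    refine le_minimalError_of_orthogonal (ι := P)
      (v := fun p => hilbertTprod (𝕜 := 𝕜) fun i => e (p.1 i)) (μ := fun p => ∏ i, l (p.1 i))
      (hv.comp (fun p : P => p.1) Subtype.val_injective) (fun p q => ?_) (fun p => ?_)
      (by simpa using hlt)
    · rw [hT]
      simp only [Subtype.ext_iff]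
      rfl
    · rw [Real.sq_sqrt (Finset.prod_nonneg fun _ _ => hl0 _)]
      exact hmin p.1 p.2
  have h2 : κ < √(∏ i, l (p0 i)) := (Real.lt_sqrt hκ0).2 ((hPmem p0).1 hp0)
  exact absurd (hlow.trans hn) (not_le.2 h2)

end TensorPower

/-! ### Counting products of terms of a decaying sequence -/

section Counting

theorem Finset.sum_le_const_mul_prod {ι : Type*} (T : Finset ι) {z : ι → ℝ} {c : ℝ} (hc : 1 < c)
    (hz : ∀ i ∈ T, c ≤ z i) : ∑ i ∈ T, z i ≤ c / (c - 1) * ∏ i ∈ T, z i := by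
  classical
  have hc1 : 0 < c - 1 := by linarith
  induction T using Finset.induction_on with
  | empty => simp only [Finset.sum_empty, Finset.prod_empty]; positivity
  | insert i T hi ih =>
    have hzi : c ≤ z i := hz i (Finset.mem_insert_self _ _)
    have hzT : ∀ k ∈ T, c ≤ z k := fun k hk => hz k (Finset.mem_insert_of_mem hk)
    have hP : 1 ≤ ∏ k ∈ T, z k :=
      Finset.one_le_prod fun k hk => hc.le.trans (hzT k hk)
    rw [Finset.sum_insert hi, Finset.prod_insert hi]
    have h1 : z i ≤ c / (c - 1) * (z i - 1) := by
      rw [div_mul_eq_mul_div, le_div_iff₀ hc1]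
      nlinarith
    have h2 : c / (c - 1) * (z i - 1) ≤ c / (c - 1) * (z i - 1) * ∏ k ∈ T, z k :=
      le_mul_of_one_le_right (by have : 0 ≤ z i - 1 := by linarith
                                 positivity) hP
    have := ih hzT
    nlinarith

/-- Counting by weights: a set of tuples of weight at least `1 / R` has at most `R A ^ d` elements
if the total weight of the alphabet is at most `A`. -/
theorem card_le_of_weights {d : ℕ} (P : Finset (Fin d → ℕ)) (J : Finset ℕ) {u : ℕ → ℝ}
    (hu : ∀ j, 0 ≤ u j) {R A : ℝ} (hR : 0 ≤ R) (hJ : ∀ p ∈ P, ∀ i, p i ∈ J)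
    (hA : ∑ j ∈ J, u j ≤ A) (hP : ∀ p ∈ P, 1 ≤ R * ∏ i, u (p i)) :
    (P.card : ℝ) ≤ R * A ^ d := by
  calc (P.card : ℝ) = ∑ p ∈ P, (1 : ℝ) := by simp
    _ ≤ ∑ p ∈ P, R * ∏ i, u (p i) := Finset.sum_le_sum hP
    _ ≤ ∑ p ∈ Fintype.piFinset fun _ : Fin d => J, R * ∏ i, u (p i) :=
        Finset.sum_le_sum_of_subset_of_nonneg
          (fun p hp => Fintype.mem_piFinset.2 fun i => hJ p hp i)
          fun p _ _ => mul_nonneg hR (Finset.prod_nonneg fun _ _ => hu _)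
    _ = R * (∑ j ∈ J, u j) ^ d := by
        rw [← Finset.mul_sum, ← Finset.prod_univ_sum]
        simp
    _ ≤ R * A ^ d := mul_le_mul_of_nonneg_left
        (pow_le_pow_left₀ (Finset.sum_nonneg fun _ _ => hu _) hA d) hR

/-- The number of `d`-tuples of indices for which the product of terms of `a` exceeds `ε²`. -/
def productCount (a : ℕ → ℝ) (ε : ℝ) (d : ℕ) : ℕ :=
  {p : Fin d → ℕ | ε ^ 2 < ∏ i, a (p i)}.ncard

/-- The sequence `a` is of lower order than `(log n)^(-2/s)`, where the term `a j` belongs to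
`n = j + 1`. The condition is solved for `log n`; terms `a j = 0`, at which the negative power would
be a junk value, satisfy it trivially and are excluded. -/
def LogDecay (s : ℝ) (a : ℕ → ℝ) : Prop :=
  ∀ δ > 0, ∃ n₀ : ℕ, ∀ j ≥ n₀, 0 < a j → Real.log ((j : ℝ) + 1) ≤ δ * a j ^ (-(s / 2))

variable {a : ℕ → ℝ} {m : ℕ} {s t : ℝ}

theorem lt_factor_of_lt_prod {d : ℕ} (ha0 : ∀ j, 0 ≤ a j) (ha1 : ∀ j, a j ≤ 1) {x : ℝ}
    {p : Fin d → ℕ} (hp : x < ∏ i, a (p i)) (i : Fin d) : x < a (p i) := by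
  refine hp.trans_le ?_
  rw [← Finset.mul_prod_erase _ _ (Finset.mem_univ i)]
  exact mul_le_of_le_one_right (ha0 _) (Finset.prod_le_one (fun _ _ => ha0 _) fun _ _ => ha1 _)

theorem finite_setOf_lt_prod (ha0 : ∀ j, 0 ≤ a j) (ha1 : ∀ j, a j ≤ 1)
    (hlim : Tendsto a atTop (𝓝 0)) {ε : ℝ} (hε : 0 < ε) (d : ℕ) :
    {p : Fin d → ℕ | ε ^ 2 < ∏ i, a (p i)}.Finite := by
  obtain ⟨M, hM⟩ := eventually_atTop.1 (hlim.eventually_lt_const (pow_pos hε 2))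
  refine (Set.Finite.pi' fun _ : Fin d => Set.finite_lt_nat M).subset fun p hp i => ?_
  by_contra h
  exact lt_asymm (hM (p i) (not_lt.1 h)) (lt_factor_of_lt_prod ha0 ha1 hp i)

theorem LogDecay.exists_sum_exp_le (h : LogDecay s a) {δ : ℝ} (hδ : 0 < δ) :
    ∃ C, 0 ≤ C ∧ ∀ J : Finset ℕ, (∀ j ∈ J, 0 < a j) →
      ∑ j ∈ J, Real.exp (-(δ * a j ^ (-(s / 2)))) ≤ Real.exp C := by
  obtain ⟨n₀, hn⟩ := h (δ / 2) (half_pos hδ)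
  have hsum : Summable fun j : ℕ => (((j : ℝ) + 1) ^ 2)⁻¹ := by
    have := (summable_nat_add_iff (f := fun j : ℕ => (((j : ℝ)) ^ 2)⁻¹) 1).2
      (Real.summable_nat_pow_inv.2 (by norm_num))
    simpa using this
  have hsum0 : 0 ≤ ∑' j : ℕ, (((j : ℝ) + 1) ^ 2)⁻¹ := tsum_nonneg fun j => by positivity
  set C := (n₀ : ℝ) + ∑' j : ℕ, (((j : ℝ) + 1) ^ 2)⁻¹ with hC
  refine ⟨C, by positivity, fun J hJ => ?_⟩
  have hterm : ∀ j ∈ J, Real.exp (-(δ * a j ^ (-(s / 2)))) ≤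
      (if j < n₀ then 1 else 0) + (((j : ℝ) + 1) ^ 2)⁻¹ := by
    intro j hj
    have hpos : 0 ≤ a j ^ (-(s / 2)) := Real.rpow_nonneg (hJ j hj).le _
    split_ifs with hjn
    · have : Real.exp (-(δ * a j ^ (-(s / 2)))) ≤ 1 :=
        Real.exp_le_one_iff.2 (neg_nonpos.2 (by positivity))
      have h2 : 0 ≤ (((j : ℝ) + 1) ^ 2)⁻¹ := by positivity
      linarith
    · have h1 := hn j (not_lt.1 hjn) (hJ j hj)
      have hj1 : (0 : ℝ) < (j : ℝ) + 1 := by positivity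
      rw [zero_add]
      calc Real.exp (-(δ * a j ^ (-(s / 2)))) ≤ Real.exp (-(2 * Real.log ((j : ℝ) + 1))) := by
            apply Real.exp_le_exp.2
            linarith
        _ = (((j : ℝ) + 1) ^ 2)⁻¹ := by
            rw [Real.exp_neg, two_mul, Real.exp_add, Real.exp_log hj1, sq]
  have hcount : ∑ j ∈ J, (if j < n₀ then (1 : ℝ) else 0) ≤ n₀ := by
    rw [Finset.sum_boole]
    have : (J.filter fun j => j < n₀) ⊆ Finset.range n₀ := fun j hj =>
      Finset.mem_range.2 (Finset.mem_filter.1 hj).2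
    have := Finset.card_le_card this
    rw [Finset.card_range] at this
    exact_mod_cast this
  calc _ ≤ ∑ j ∈ J, ((if j < n₀ then (1 : ℝ) else 0) + (((j : ℝ) + 1) ^ 2)⁻¹) :=
        Finset.sum_le_sum hterm
    _ ≤ C := by
        rw [Finset.sum_add_distrib]
        exact add_le_add hcount (hsum.sum_le_tsum J fun j _ => by positivity)
    _ ≤ Real.exp C := by linarith [Real.add_one_le_exp C]

/-- The counting bound behind sufficiency. Indices below `m` get weight `1`, the index `j ≥ m`
gets weight `exp (-δ a_j^(-s/2) - C) / d`, so that the total weight is at most `m + 1 / d`. -/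
theorem LogDecay.exists_log_productCount_le (h : LogDecay s a) (hs : 0 < s)
    (ha0 : ∀ j, 0 ≤ a j) (hm1 : 1 ≤ m) (ham : ∀ j < m, a j = 1) {q : ℝ} (hq0 : 0 < q) (hq1 : q < 1)
    (hq : ∀ j, m ≤ j → a j ≤ q) (hlim : Tendsto a atTop (𝓝 0)) {δ : ℝ} (hδ : 0 < δ) :
    ∃ C B, 0 ≤ C ∧ 0 ≤ B ∧ ∀ (ε : ℝ) (d : ℕ), 0 < ε → ε < 1 → 1 ≤ d →
      Real.log (productCount a ε d) ≤
        1 + d * Real.log m + δ * ε ^ (-s) + (C + Real.log d) * (B * -Real.log ε) := by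
  classical
  -- Every index `j ≥ m` contributes a factor at least `c` to the product of the `a_j^(-s/2)`.
  set c : ℝ := q ^ (-(s / 2)) with hc
  have hc1 : 1 < c := Real.one_lt_rpow_of_pos_of_lt_one_of_neg hq0 hq1 (by linarith)
  have hlogc : 0 < Real.log c := Real.log_pos hc1
  have hD : 0 < c / (c - 1) := div_pos (by linarith) (by linarith)
  set δ' := δ / (c / (c - 1)) with hδ'
  have hδ'0 : 0 < δ' := div_pos hδ hD
  obtain ⟨C, hC0, hC⟩ := h.exists_sum_exp_le hδ'0
  refine ⟨C, s / Real.log c, hC0, by positivity, fun ε d hε hε1 hd => ?_⟩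
  have hlogε : 0 < -Real.log ε := neg_pos.2 (Real.log_neg hε hε1)
  have hdpos : (0 : ℝ) < d := by exact_mod_cast hd
  have hlogd : 0 ≤ Real.log d := Real.log_natCast_nonneg d
  have hmpos : (0 : ℝ) < m := by exact_mod_cast hm1
  have ha1 : ∀ j, a j ≤ 1 := fun j => by
    rcases lt_or_ge j m with hj | hj
    · exact (ham j hj).le
    · exact (hq j hj).trans hq1.le
  have hfin := finite_setOf_lt_prod ha0 ha1 hlim hε d
  set P := hfin.toFinset with hP
  have hcard : productCount a ε d = P.card := Set.ncard_eq_toFinset_card _ hfin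
  have hPmem : ∀ p ∈ P, ε ^ 2 < ∏ i, a (p i) := fun p hp => hfin.mem_toFinset.1 hp
  let J : Finset ℕ := P.biUnion fun p => Finset.univ.image p
  have hJ : ∀ p ∈ P, ∀ i, p i ∈ J := fun p hp i =>
    Finset.mem_biUnion.2 ⟨p, hp, Finset.mem_image_of_mem _ (Finset.mem_univ i)⟩
  have hJpos : ∀ j ∈ J, 0 < a j := by
    intro j hj
    obtain ⟨p, hp, hjp⟩ := Finset.mem_biUnion.1 hj
    obtain ⟨i, -, rfl⟩ := Finset.mem_image.1 hjp
    exact (by positivity : 0 < ε ^ 2).trans (lt_factor_of_lt_prod ha0 ha1 (hPmem p hp) i)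
  let g : ℕ → ℝ := fun j =>
    if j < m then 0 else δ' * a j ^ (-(s / 2)) + (C + Real.log d)
  let u : ℕ → ℝ := fun j => Real.exp (-g j)
  have hA : ∑ j ∈ J, u j ≤ m * Real.exp (1 / d) := by
    rw [← Finset.sum_filter_add_sum_filter_not J (fun j => j < m)]
    have h1 : ∑ j ∈ J with j < m, u j ≤ m := by
      have : ∑ j ∈ J with j < m, u j = ((J.filter fun j => j < m).card : ℝ) := by
        rw [Finset.card_eq_sum_ones, Nat.cast_sum]
        refine Finset.sum_congr rfl fun j hj => ?_
        simp [u, g, (Finset.mem_filter.1 hj).2]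
      rw [this]
      have hsub : (J.filter fun j => j < m) ⊆ Finset.range m := fun j hj =>
        Finset.mem_range.2 (Finset.mem_filter.1 hj).2
      have := Finset.card_le_card hsub
      rw [Finset.card_range] at this
      exact_mod_cast this
    have h2 : ∑ j ∈ J with ¬ j < m, u j ≤ 1 / d := by
      have hu : ∀ j ∈ J.filter (fun j => ¬ j < m), u j =
          Real.exp (-(δ' * a j ^ (-(s / 2)))) * (Real.exp (-C) * (1 / d)) := by
        intro j hj
        simp only [u, g, if_neg (Finset.mem_filter.1 hj).2]
        rw [neg_add, Real.exp_add, neg_add, Real.exp_add, Real.exp_neg (Real.log d),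
          Real.exp_log hdpos, one_div]
      rw [Finset.sum_congr rfl hu, ← Finset.sum_mul]
      calc _ ≤ Real.exp C * (Real.exp (-C) * (1 / d)) :=
            mul_le_mul_of_nonneg_right (hC _ fun j hj => hJpos j (Finset.mem_filter.1 hj).1)
              (by positivity)
        _ = 1 / d := by rw [← mul_assoc, ← Real.exp_add, add_neg_cancel, Real.exp_zero, one_mul]
    have h3 : (1 : ℝ) / d ≤ m * (1 / d) :=
      le_mul_of_one_le_left (by positivity) (by exact_mod_cast hm1)
    have h4 : (m : ℝ) * (1 / d + 1) ≤ m * Real.exp (1 / d) :=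
      mul_le_mul_of_nonneg_left (Real.add_one_le_exp _) hmpos.le
    linarith
  set b := δ * ε ^ (-s) + (C + Real.log d) * (s / Real.log c * -Real.log ε) with hb
  have hg : ∀ p ∈ P, ∑ i, g (p i) ≤ b := by
    intro p hp
    let T : Finset (Fin d) := {i | ¬ p i < m}
    have hTa : ∏ i ∈ T, a (p i) = ∏ i, a (p i) := by
      refine Finset.prod_subset (Finset.subset_univ _) fun i _ hi => ham _ ?_
      simpa [T] using hi
    have hapos : ∀ i, 0 < a (p i) := fun i => hJpos _ (hJ p hp i)
    have hz : ∀ i ∈ T, c ≤ a (p i) ^ (-(s / 2)) := fun i hi => by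
      refine Real.rpow_le_rpow_of_nonpos (hapos i) (hq _ ?_) (by linarith)
      simpa [T] using hi
    have hprod : ∏ i ∈ T, a (p i) ^ (-(s / 2)) ≤ ε ^ (-s) := by
      rw [Real.finsetProd_rpow _ _ fun i _ => (hapos i).le, hTa]
      have : ε ^ (-s) = (ε ^ 2) ^ (-(s / 2)) := by
        rw [← Real.rpow_natCast, ← Real.rpow_mul hε.le]
        congr 1
        push_cast
        ring
      rw [this]
      exact Real.rpow_le_rpow_of_nonpos (by positivity) (hPmem p hp).le (by linarith)
    have hsum : ∑ i ∈ T, a (p i) ^ (-(s / 2)) ≤ c / (c - 1) * ε ^ (-s) :=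
      (T.sum_le_const_mul_prod hc1 hz).trans (mul_le_mul_of_nonneg_left hprod hD.le)
    have hT : (T.card : ℝ) ≤ s / Real.log c * -Real.log ε := by
      have h1 : c ^ T.card ≤ ε ^ (-s) := by
        refine le_trans ?_ hprod
        rw [← Finset.prod_const]
        exact Finset.prod_le_prod (fun _ _ => by positivity) hz
      have h2 := Real.log_le_log (by positivity) h1
      rw [Real.log_pow, Real.log_rpow hε] at h2
      rw [div_mul_eq_mul_div, le_div_iff₀ hlogc]
      linarith
    have hgsum : ∑ i, g (p i) =
        δ' * ∑ i ∈ T, a (p i) ^ (-(s / 2)) + (C + Real.log d) * T.card := by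
      have : ∑ i, g (p i) = ∑ i ∈ T, g (p i) := by
        refine (Finset.sum_subset (Finset.subset_univ _) fun i _ hi => ?_).symm
        have : p i < m := by simpa [T] using hi
        simp [g, this]
      rw [this, Finset.mul_sum, mul_comm (C + Real.log d), ← nsmul_eq_mul, ← Finset.sum_const,
        ← Finset.sum_add_distrib]
      refine Finset.sum_congr rfl fun i hi => ?_
      have : ¬ p i < m := by simpa [T] using hi
      simp [g, this]
    rw [hgsum, hb]
    refine add_le_add ?_ (mul_le_mul_of_nonneg_left hT (by positivity))
    calc _ ≤ δ' * (c / (c - 1) * ε ^ (-s)) := mul_le_mul_of_nonneg_left hsum hδ'0.le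
      _ = δ * ε ^ (-s) := by rw [← mul_assoc, hδ', div_mul_cancel₀ _ hD.ne']
  have hmain : (P.card : ℝ) ≤ Real.exp b * (m * Real.exp (1 / d)) ^ d := by
    refine card_le_of_weights P J (fun j => (Real.exp_pos _).le) (Real.exp_pos b).le hJ hA
      fun p hp => ?_
    rw [← Real.exp_sum, ← Real.exp_add, Finset.sum_neg_distrib]
    exact Real.one_le_exp (by linarith [hg p hp])
  -- The constant tuple `0` is counted, so the logarithm below is that of a positive number.
  have hPcard : (0 : ℝ) < P.card := by
    refine Nat.cast_pos.2 (Finset.card_pos.2 ⟨fun _ => 0, hfin.mem_toFinset.2 ?_⟩)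
    rw [Set.mem_ofPred_eq]
    simp only [ham 0 hm1, Finset.prod_const_one]
    nlinarith
  rw [hcard]
  have := Real.log_le_log hPcard hmain
  rw [Real.log_mul (by positivity) (by positivity), Real.log_exp, Real.log_pow,
    Real.log_mul hmpos.ne' (by positivity), Real.log_exp, mul_add, mul_one_div_cancel hdpos.ne']
    at this
  rw [hb] at this
  linarith

end Counting

/-! ### Asymptotics and weak tractability -/

section Tractability

variable {a : ℕ → ℝ} {m : ℕ} {s t : ℝ}

/-- Squared logarithms are of lower order than any power; proved through `log x ≤ (4 / r) x^(r/4)`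
and the inequality of arithmetic and geometric means. -/
theorem exists_sq_log_le {r δ : ℝ} (hr : 0 < r) (hδ : 0 < δ) {C B : ℝ} (hC : 0 ≤ C) (hB : 0 ≤ B) :
    ∃ K, ∀ x : ℝ, 1 ≤ x → B * (C + Real.log x) ^ 2 ≤ δ * x ^ r + K := by
  set M := B * (C + 4 / r) ^ 2 with hM
  refine ⟨M ^ 2 / (4 * δ), fun x hx => ?_⟩
  set y := x ^ (r / 4) with hy
  have hy1 : 1 ≤ y := Real.one_le_rpow hx (by positivity)
  have hlog : Real.log x ≤ y * (4 / r) := by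
    have := Real.log_le_rpow_div (by linarith : 0 ≤ x) (by positivity : 0 < r / 4)
    rw [← hy, div_div_eq_mul_div, mul_div_assoc] at this
    exact this
  have hlog0 := Real.log_nonneg hx
  have h4 : x ^ r = y ^ 4 := by
    rw [hy, ← Real.rpow_natCast, ← Real.rpow_mul (by linarith)]
    congr 1
    push_cast
    ring
  have h1 : C + Real.log x ≤ (C + 4 / r) * y := by nlinarith
  have h2 : B * (C + Real.log x) ^ 2 ≤ M * y ^ 2 := by
    rw [hM, mul_assoc, ← mul_pow]
    exact mul_le_mul_of_nonneg_left (pow_le_pow_left₀ (by positivity) h1 2) hB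
  have h3 : M * y ^ 2 ≤ δ * y ^ 4 + M ^ 2 / (4 * δ) := by
    have : δ * y ^ 4 + M ^ 2 / (4 * δ) - M * y ^ 2 = (2 * δ * y ^ 2 - M) ^ 2 / (4 * δ) := by
      field_simp
      ring
    have h5 : 0 ≤ (2 * δ * y ^ 2 - M) ^ 2 / (4 * δ) := by positivity
    linarith
  rw [h4]
  exact h2.trans h3

theorem exists_mul_le_rpow (ht : 1 < t) {δ : ℝ} (hδ : 0 < δ) {B : ℝ} (hB : 0 ≤ B) :
    ∃ K, ∀ x : ℝ, 1 ≤ x → x * B ≤ δ * x ^ t + K := by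
  obtain ⟨X, hX⟩ := eventually_atTop.1
    ((tendsto_rpow_atTop (by linarith : 0 < t - 1)).eventually_ge_atTop (B / δ))
  refine ⟨|X| * B, fun x hx => ?_⟩
  have hx0 : 0 < x := by linarith
  rcases le_or_gt X x with h | h
  · have h1 := hX x h
    rw [div_le_iff₀ hδ] at h1
    have h2 : x ^ t = x * x ^ (t - 1) := by
      rw [Real.rpow_sub_one hx0.ne', mul_div_cancel₀ _ hx0.ne']
    have h3 : 0 ≤ |X| * B := by positivity
    rw [h2]
    nlinarith [mul_le_mul_of_nonneg_left h1 hx0.le]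
  · have h1 : x * B ≤ |X| * B := mul_le_mul_of_nonneg_right (h.le.trans (le_abs_self X)) hB
    have h2 : 0 ≤ δ * x ^ t := by positivity
    linarith

theorem isWeaklyTractable_congr {n n' : ℝ → ℕ → ℕ}
    (h : ∀ ε d, 0 < ε → ε < 1 → 1 ≤ d → n ε d = n' ε d) :
    IsWeaklyTractable s t n ↔ IsWeaklyTractable s t n' := by
  refine forall_congr' fun ε => forall_congr' fun d => imp_congr_right fun hε =>
    imp_congr_right fun hd => imp_congr_right fun _ => ?_
  have : (fun k => Real.log (n (ε k) (d k)) / ((ε k) ^ (-s) + (d k : ℝ) ^ t)) =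
      fun k => Real.log (n' (ε k) (d k)) / ((ε k) ^ (-s) + (d k : ℝ) ^ t) := by
    funext k
    rw [h _ _ (hε k).1 (hε k).2 (hd k)]
  rw [this]

theorem tendsto_rpow_neg_add_rpow (hs : 0 < s) (ht : 0 < t) {ε : ℕ → ℝ} {d : ℕ → ℕ}
    (hε : ∀ k, 0 < ε k ∧ ε k < 1) (hd : ∀ k, 1 ≤ d k)
    (h : Tendsto (fun k => (ε k)⁻¹ + (d k : ℝ)) atTop atTop) :
    Tendsto (fun k => (ε k) ^ (-s) + (d k : ℝ) ^ t) atTop atTop := by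
  have hr : 0 < min s t := lt_min hs ht
  have h1 : Tendsto (fun k => (((ε k)⁻¹ + (d k : ℝ)) / 2) ^ min s t) atTop atTop :=
    (tendsto_rpow_atTop hr).comp (h.atTop_div_const two_pos)
  refine tendsto_atTop_mono (fun k => ?_) h1
  have hε' : 1 ≤ (ε k)⁻¹ := (one_le_inv₀ (hε k).1).2 (hε k).2.le
  have hd' : (1 : ℝ) ≤ d k := by exact_mod_cast hd k
  have h2 : (ε k)⁻¹ ^ min s t ≤ (ε k) ^ (-s) := by
    rw [Real.rpow_neg (hε k).1.le, ← Real.inv_rpow (hε k).1.le]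
    exact Real.rpow_le_rpow_of_exponent_le hε' (min_le_left _ _)
  have h3 : (d k : ℝ) ^ min s t ≤ (d k : ℝ) ^ t :=
    Real.rpow_le_rpow_of_exponent_le hd' (min_le_right _ _)
  have h4 : 0 ≤ (ε k) ^ (-s) := Real.rpow_nonneg (hε k).1.le _
  have h5 : 0 ≤ (d k : ℝ) ^ t := by positivity
  rcases le_total (ε k)⁻¹ (d k : ℝ) with h | h
  · have := Real.rpow_le_rpow (by positivity) (by linarith : ((ε k)⁻¹ + (d k : ℝ)) / 2 ≤ d k) hr.le
    linarith
  · have := Real.rpow_le_rpow (by positivity)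
      (by linarith : ((ε k)⁻¹ + (d k : ℝ)) / 2 ≤ (ε k)⁻¹) hr.le
    linarith

/-- A non-sequential criterion: the constant `K` is negligible because the denominator diverges
along each admissible sequence. -/
theorem isWeaklyTractable_of_log_le (hs : 0 < s) (ht : 0 < t) {n : ℝ → ℕ → ℕ}
    (h : ∀ δ > 0, ∃ K, ∀ (ε : ℝ) (d : ℕ), 0 < ε → ε < 1 → 1 ≤ d →
      Real.log (n ε d) ≤ δ * (ε ^ (-s) + (d : ℝ) ^ t) + K) :
    IsWeaklyTractable s t n := by
  intro ε d hε hd hlim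
  have hden := tendsto_rpow_neg_add_rpow hs ht hε hd hlim
  rw [Metric.tendsto_nhds]
  intro η hη
  obtain ⟨K, hK⟩ := h (η / 2) (half_pos hη)
  filter_upwards [hden.eventually_gt_atTop (2 * |K| / η), hden.eventually_gt_atTop 0]
    with k hk hk0
  have h1 := hK (ε k) (d k) (hε k).1 (hε k).2 (hd k)
  rw [Real.dist_eq, sub_zero, abs_of_nonneg (div_nonneg (Real.log_natCast_nonneg _) hk0.le),
    div_lt_iff₀ hk0]
  rw [div_lt_iff₀ hη] at hk
  have := le_abs_self K
  linarith

/-- Sufficiency, for both multiplicities: the term `d log m` coming from the largest eigenvalue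
vanishes for `m = 1` and is of lower order than `d ^ t` for `t > 1`. -/
theorem LogDecay.isWeaklyTractable (h : LogDecay s a) (hs : 0 < s) (ht : 0 < t)
    (ha0 : ∀ j, 0 ≤ a j) (hm1 : 1 ≤ m) (hmt : m = 1 ∨ 1 < t) (ham : ∀ j < m, a j = 1)
    {q : ℝ} (hq0 : 0 < q) (hq1 : q < 1)
    (hq : ∀ j, m ≤ j → a j ≤ q) (hlim : Tendsto a atTop (𝓝 0)) :
    IsWeaklyTractable s t (productCount a) := by
  refine isWeaklyTractable_of_log_le hs ht fun δ hδ => ?_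
  have hδ3 : 0 < δ / 3 := by positivity
  obtain ⟨C, B, hC, hB, hbound⟩ :=
    h.exists_log_productCount_le hs ha0 hm1 ham hq0 hq1 hq hlim hδ3
  obtain ⟨K₁, hK₁⟩ := exists_sq_log_le ht hδ3 hC zero_le_one
  obtain ⟨K₂, hK₂⟩ := exists_sq_log_le hs hδ3 le_rfl (sq_nonneg B)
  have hK₃ : ∃ K, ∀ x : ℝ, 1 ≤ x → x * Real.log m ≤ δ / 3 * x ^ t + K := by
    rcases hmt with rfl | ht1
    · exact ⟨0, fun x hx => by simp only [Nat.cast_one, Real.log_one, mul_zero]; positivity⟩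
    · exact exists_mul_le_rpow ht1 hδ3 (Real.log_natCast_nonneg m)
  obtain ⟨K₃, hK₃⟩ := hK₃
  refine ⟨1 + |K₁| + |K₂| + K₃, fun ε d hε hε1 hd => ?_⟩
  have hd' : (1 : ℝ) ≤ d := by exact_mod_cast hd
  have h1 := hbound ε d hε hε1 hd
  have h2 := hK₁ d hd'
  have h3 := hK₂ ε⁻¹ ((one_le_inv₀ hε).2 hε1.le)
  have h4 := hK₃ d hd'
  rw [Real.inv_rpow hε.le, ← Real.rpow_neg hε.le, Real.log_inv, zero_add, ← mul_pow] at h3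
  rw [one_mul] at h2
  have h5 : (C + Real.log d) * (B * -Real.log ε) ≤
      ((C + Real.log d) ^ 2 + (B * -Real.log ε) ^ 2) / 2 := by
    linarith [two_mul_le_add_sq (C + Real.log d) (B * -Real.log ε)]
  have h6 : 0 ≤ δ / 3 * ε ^ (-s) := by positivity
  have h7 : 0 ≤ δ / 3 * (d : ℝ) ^ t := by positivity
  have := le_abs_self K₁
  have := le_abs_self K₂
  have := abs_nonneg K₁
  have := abs_nonneg K₂
  linarith

/-- Necessity of the decay condition, from the univariate problem alone: for `ε² = a_j / 2` all
indices up to `j` are counted. -/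
theorem IsWeaklyTractable.logDecay (h : IsWeaklyTractable s t (productCount a)) (hs : 0 < s)
    (ha0 : ∀ j, 0 ≤ a j) (ha1 : ∀ j, a j ≤ 1) (hanti : Antitone a)
    (hlim : Tendsto a atTop (𝓝 0)) : LogDecay s a := by
  have huniv : ∀ δ > 0, ∃ ε₀ > 0, ∀ ε, 0 < ε → ε < 1 → ε < ε₀ →
      Real.log (productCount a ε 1) ≤ δ * (ε ^ (-s) + 1) := by
    intro δ hδ
    by_contra! hcon
    choose! ε hε0 hε1 hε2 hε3 using fun k : ℕ => hcon (1 / ((k : ℝ) + 1)) (by positivity)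
    have hto : Tendsto (fun k => (ε k)⁻¹ + ((1 : ℕ) : ℝ)) atTop atTop := by
      refine tendsto_atTop_mono (fun k => ?_) tendsto_natCast_atTop_atTop
      have : (k : ℝ) + 1 ≤ (ε k)⁻¹ := by
        rw [le_inv_comm₀ (by positivity) (hε0 k), ← one_div]
        exact (hε2 k).le
      push_cast
      linarith
    have := h ε (fun _ => 1) (fun k => ⟨hε0 k, hε1 k⟩) (fun _ => le_rfl) hto
    obtain ⟨k, hk⟩ := (this.eventually_lt_const hδ).exists
    have hpos : 0 < (ε k) ^ (-s) + ((1 : ℕ) : ℝ) ^ t := by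
      have := Real.rpow_nonneg (hε0 k).le (-s)
      simp only [Nat.cast_one, Real.one_rpow]
      linarith
    rw [div_lt_iff₀ hpos] at hk
    simp only [Nat.cast_one, Real.one_rpow] at hk
    exact absurd hk (not_lt.2 (hε3 k).le)
  intro η hη
  have h2s : (0 : ℝ) < 2 ^ (s / 2) + 1 := by positivity
  obtain ⟨ε₀, hε₀, hbound⟩ := huniv (η / (2 ^ (s / 2) + 1)) (by positivity)
  obtain ⟨M, hM⟩ := eventually_atTop.1 (hlim.eventually_lt_const (pow_pos hε₀ 2))
  refine ⟨M, fun j hj haj => ?_⟩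
  set ε := √(a j / 2) with hε
  have hε0 : 0 < ε := Real.sqrt_pos.2 (by linarith)
  have hεsq : ε ^ 2 = a j / 2 := Real.sq_sqrt (by linarith)
  have hε1 : ε < 1 := by
    rw [hε, Real.sqrt_lt' one_pos]
    linarith [ha1 j]
  have hεε₀ : ε < ε₀ := by
    rw [hε, Real.sqrt_lt' hε₀]
    linarith [hM j hj]
  have hcount : j + 1 ≤ productCount a ε 1 := by
    have hsub : (fun (i : ℕ) (_ : Fin 1) => i) '' (Finset.range (j + 1) : Set ℕ) ⊆
        {p : Fin 1 → ℕ | ε ^ 2 < ∏ i, a (p i)} := by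
      rintro _ ⟨i, hi, rfl⟩
      have hij : i ≤ j := Nat.lt_succ_iff.1 (Finset.mem_range.1 hi)
      rw [Set.mem_ofPred_eq, Fin.prod_univ_one, hεsq]
      linarith [hanti hij]
    have := Set.ncard_le_ncard hsub (finite_setOf_lt_prod ha0 ha1 hlim hε0 1)
    rwa [Set.ncard_image_of_injective _ fun i k h => congrFun h 0, Set.ncard_coe_finset,
      Finset.card_range] at this
  have h1 : Real.log ((j : ℝ) + 1) ≤ Real.log (productCount a ε 1) :=
    Real.log_le_log (by positivity) (by exact_mod_cast hcount)
  have h2 : ε ^ (-s) = 2 ^ (s / 2) * a j ^ (-(s / 2)) := by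
    have : ε ^ (-s) = (ε ^ 2) ^ (-(s / 2)) := by
      rw [← Real.rpow_natCast, ← Real.rpow_mul hε0.le]
      congr 1
      push_cast
      ring
    rw [this, hεsq, Real.div_rpow haj.le two_pos.le, Real.rpow_neg two_pos.le, div_inv_eq_mul,
      mul_comm]
  have h3 : 1 ≤ a j ^ (-(s / 2)) :=
    Real.one_le_rpow_of_pos_of_le_one_of_nonpos haj (ha1 j) (by linarith)
  calc _ ≤ _ := h1
    _ ≤ _ := hbound ε hε0 hε1 hεε₀
    _ ≤ η / (2 ^ (s / 2) + 1) * ((2 ^ (s / 2) + 1) * a j ^ (-(s / 2))) :=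
        mul_le_mul_of_nonneg_left (by rw [h2]; linarith) (by positivity)
    _ = η * a j ^ (-(s / 2)) := by rw [← mul_assoc, div_mul_cancel₀ _ h2s.ne']

/-- If the largest term has multiplicity `m > 1`, then for each `ε < 1` at least `m ^ d` tuples are
counted, which forces `t > 1`. -/
theorem IsWeaklyTractable.one_lt (h : IsWeaklyTractable s t (productCount a))
    (ha0 : ∀ j, 0 ≤ a j) (ha1 : ∀ j, a j ≤ 1) (hlim : Tendsto a atTop (𝓝 0))
    (hm : 1 < m) (ham : ∀ j < m, a j = 1) : 1 < t := by
  by_contra! ht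
  have hto : Tendsto (fun k : ℕ => ((1 / 2 : ℝ))⁻¹ + ((k + 1 : ℕ) : ℝ)) atTop atTop :=
    tendsto_atTop_add_const_left _ _
      (tendsto_natCast_atTop_atTop.comp (tendsto_add_atTop_nat 1))
  have h1 := h (fun _ => 1 / 2) (fun k => k + 1) (fun _ => by norm_num) (fun _ => by omega) hto
  set D : ℝ := (1 / 2 : ℝ) ^ (-s) with hD
  have hD0 : 0 < D := by positivity
  have hlogm : 0 < Real.log m := Real.log_pos (by exact_mod_cast hm)
  obtain ⟨k, hk⟩ :=
    (h1.eventually_lt_const (show 0 < Real.log m / (D + 1) by positivity)).exists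
  have hcount : m ^ (k + 1) ≤ productCount a (1 / 2) (k + 1) := by
    have hsub : (Fintype.piFinset (fun _ : Fin (k + 1) => Finset.range m) : Set (Fin (k + 1) → ℕ)) ⊆
        {p : Fin (k + 1) → ℕ | (1 / 2 : ℝ) ^ 2 < ∏ i, a (p i)} := by
      intro p hp
      rw [Set.mem_ofPred_eq, Finset.prod_eq_one]
      · norm_num
      · exact fun i _ => ham _ (Finset.mem_range.1 (Fintype.mem_piFinset.1 hp i))
    have := Set.ncard_le_ncard hsub (finite_setOf_lt_prod ha0 ha1 hlim (by norm_num) _)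
    rwa [Set.ncard_coe_finset, Fintype.card_piFinset_const, Finset.card_range] at this
  have h2 : ((k + 1 : ℕ) : ℝ) * Real.log m ≤ Real.log (productCount a (1 / 2) (k + 1)) := by
    rw [← Real.log_pow]
    exact Real.log_le_log (by positivity) (by exact_mod_cast hcount)
  have hk1 : (1 : ℝ) ≤ ((k + 1 : ℕ) : ℝ) := by exact_mod_cast Nat.succ_le_succ (Nat.zero_le k)
  have h3 : ((k + 1 : ℕ) : ℝ) ^ t ≤ ((k + 1 : ℕ) : ℝ) := by
    simpa using Real.rpow_le_rpow_of_exponent_le hk1 ht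
  have hden : 0 < D + ((k + 1 : ℕ) : ℝ) ^ t := by positivity
  rw [div_lt_div_iff₀ hden (by positivity)] at hk
  have h4 : D + ((k + 1 : ℕ) : ℝ) ^ t ≤ (k + 1 : ℕ) * (D + 1) := by nlinarith
  have h5 : Real.log m * (D + ((k + 1 : ℕ) : ℝ) ^ t) ≤
      Real.log m * ((k + 1 : ℕ) * (D + 1)) := mul_le_mul_of_nonneg_left h4 hlogm.le
  have h6 := mul_le_mul_of_nonneg_right h2 (show 0 ≤ D + 1 by positivity)
  linarith

/-- Translation between the two ways of writing the decay condition, with `x = log n`. -/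
theorem le_mul_rpow_iff_div_rpow_le {x y δ : ℝ} (hx : 0 < x) (hy : 0 < y) (hδ : 0 < δ)
    (hs : 0 < s) : x ≤ δ * y ^ (-(s / 2)) ↔ y / x ^ (-2 / s) ≤ δ ^ (2 / s) := by
  have h1 : y / x ^ (-2 / s) = (y ^ (s / 2) * x) ^ (2 / s) := by
    rw [Real.mul_rpow (by positivity) hx.le, ← Real.rpow_mul hy.le, neg_div,
      Real.rpow_neg hx.le, div_inv_eq_mul]
    congr 1
    rw [div_mul_div_comm, mul_comm s 2, div_self (by positivity), Real.rpow_one]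
  rw [h1, Real.rpow_le_rpow_iff (by positivity) hδ.le (by positivity), Real.rpow_neg hy.le,
    ← div_eq_mul_inv, le_div_iff₀ (by positivity), mul_comm]

theorem logDecay_iff_tendsto (hs : 0 < s) {l : ℕ → ℝ} {L : ℝ} (hL : 0 < L)
    (hl : ∀ j, 0 ≤ l (j + 1)) :
    LogDecay s (fun j => l (j + 1) / L) ↔
      Tendsto (fun n : ℕ => l n / Real.log n ^ (-2 / s)) atTop (𝓝 0) := by
  rw [← tendsto_add_atTop_iff_nat 1, Metric.tendsto_atTop]
  have hlog : ∀ j : ℕ, 1 ≤ j → 0 < Real.log ((j : ℝ) + 1) := fun j hj =>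
    Real.log_pos (by have : (1 : ℝ) ≤ j := by exact_mod_cast hj
                     linarith)
  constructor
  · intro h η hη
    obtain ⟨n₀, hn⟩ := h ((η / (2 * L)) ^ (s / 2)) (by positivity)
    refine ⟨max n₀ 1, fun j hj => ?_⟩
    have hx := hlog j (le_trans (le_max_right _ _) hj)
    rw [Nat.cast_add, Nat.cast_one, Real.dist_eq, sub_zero,
      abs_of_nonneg (div_nonneg (hl j) (Real.rpow_nonneg hx.le _))]
    rcases (hl j).eq_or_lt with h0 | hpos
    · rw [← h0, zero_div]; exact hη
    · have h1 := hn j (le_trans (le_max_left _ _) hj) (div_pos hpos hL)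
      rw [le_mul_rpow_iff_div_rpow_le hx (div_pos hpos hL) (by positivity) hs,
        ← Real.rpow_mul (by positivity), div_mul_div_comm, mul_comm s 2, div_self (by positivity),
        Real.rpow_one, div_right_comm, div_le_iff₀ hL] at h1
      have h2 : η / (2 * L) * L = η / 2 := by field_simp
      linarith
  · intro h δ hδ
    obtain ⟨n₀, hn⟩ := h (L * δ ^ (2 / s)) (by positivity)
    refine ⟨max n₀ 1, fun j hj hpos => ?_⟩
    have hx := hlog j (le_trans (le_max_right _ _) hj)
    have h1 := hn j (le_trans (le_max_left _ _) hj)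
    rw [Nat.cast_add, Nat.cast_one, Real.dist_eq, sub_zero,
      abs_of_nonneg (div_nonneg (hl j) (Real.rpow_nonneg hx.le _))] at h1
    rw [le_mul_rpow_iff_div_rpow_le hx hpos hδ hs, div_right_comm, div_le_iff₀ hL, mul_comm]
    exact h1.le

end Tractability

end

theorem mainTheorem2 {𝕜 H G : Type*} [RCLike 𝕜]
    [NormedAddCommGroup H] [InnerProductSpace 𝕜 H] [CompleteSpace H]
    [NormedAddCommGroup G] [InnerProductSpace 𝕜 G] [CompleteSpace G]
    (S₁ : H →L[𝕜] G) (hS₁ : IsCompactOperator S₁)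
    (W₁ : H →L[𝕜] H) (hW₁ : W₁ = ContinuousLinearMap.adjoint S₁ ∘L S₁)
    (lam : ℕ → ℝ) (hlam : ∀ n, lam n = orderedEigenvalue W₁ n) (hlam2 : 0 < lam 2)
    (m : ℕ) (hm : m = Module.finrank 𝕜 (Module.End.eigenspace W₁.toLinearMap (lam 1 : 𝕜)))
    (s t : ℝ) (hs : 0 < s) (ht : 0 < t) :
    (m = 1 →
      (IsWeaklyTractable s t (fun ε d => normalizedInfoComplexity ε (tensorProductProblem S₁ d)) ↔
        Tendsto (fun n : ℕ => lam n / (Real.log n) ^ (-2 / s)) atTop (𝓝 0))) ∧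
    (1 < m →
      (IsWeaklyTractable s t (fun ε d => normalizedInfoComplexity ε (tensorProductProblem S₁ d)) ↔
        1 < t ∧ Tendsto (fun n : ℕ => lam n / (Real.log n) ^ (-2 / s)) atTop (𝓝 0))) := by
  obtain rfl : lam = orderedEigenvalue W₁ := funext hlam
  have hpos : 0 < orderedEigenvalue W₁ 1 :=
    hlam2.trans_le (orderedEigenvalue_anti hW₁ le_rfl one_le_two)
  set L := orderedEigenvalue W₁ 1 with hL
  set a : ℕ → ℝ := fun j => orderedEigenvalue W₁ (j + 1) / L with ha
  have hnn : ∀ j : ℕ, 0 ≤ orderedEigenvalue W₁ (j + 1) := fun j =>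
    orderedEigenvalue_nonneg hW₁ (by omega)
  have ha0 : ∀ j, 0 ≤ a j := fun j => div_nonneg (hnn j) hpos.le
  have hanti : Antitone a := fun i j hij =>
    div_le_div_of_nonneg_right (orderedEigenvalue_anti hW₁ (by omega) (by omega)) hpos.le
  have ha00 : a 0 = 1 := div_self hpos.ne'
  have ha1 : ∀ j, a j ≤ 1 := fun j => ha00 ▸ hanti (Nat.zero_le j)
  have hlim : Tendsto a atTop (𝓝 0) := by
    simpa using (tendsto_orderedEigenvalue hS₁ hW₁).div_const L
  have hmul : ∀ j, a j = 1 ↔ j < m := fun j => by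
    rw [hm, ← orderedEigenvalue_eq_first_iff hS₁ hW₁ hpos, ha, div_eq_one_iff_eq hpos.ne']
  have hm1 : 1 ≤ m := (hmul 0).1 ha00
  have hq1 : a m < 1 := lt_of_le_of_ne (ha1 m) fun h => lt_irrefl m ((hmul m).1 h)
  have hdecay := logDecay_iff_tendsto (l := orderedEigenvalue W₁) hs hpos hnn
  have hcongr : IsWeaklyTractable s t
      (fun ε d => normalizedInfoComplexity ε (tensorProductProblem S₁ d)) ↔
      IsWeaklyTractable s t (productCount a) := by
    refine isWeaklyTractable_congr fun ε d hε hε1 hd => ?_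
    rw [normalizedInfoComplexity_tensorProductProblem hS₁ hW₁ hpos hd hε hε1, productCount]
    congr 1
    ext p
    simp only [Set.mem_ofPred_eq, ha, Finset.prod_div_distrib, Finset.prod_const,
      Finset.card_univ, Fintype.card_fin]
    rw [lt_div_iff₀ (pow_pos hpos d)]
  have hsuff : (m = 1 ∨ 1 < t) → LogDecay s a → IsWeaklyTractable s t (productCount a) :=
    fun hmt h => h.isWeaklyTractable hs ht ha0 hm1 hmt (fun j hj => (hmul j).2 hj)
      (q := max (a m) (1 / 2)) (lt_max_of_lt_right one_half_pos) (max_lt hq1 one_half_lt_one)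
      (fun j hj => (hanti hj).trans (le_max_left _ _)) hlim
  rw [hcongr, ← hdecay]
  exact ⟨fun h1 => ⟨fun h => h.logDecay hs ha0 ha1 hanti hlim, hsuff (Or.inl h1)⟩,
    fun h1 => ⟨fun h => ⟨h.one_lt ha0 ha1 hlim h1 fun j hj => (hmul j).2 hj,
      h.logDecay hs ha0 ha1 hanti hlim⟩, fun h => hsuff (Or.inr h.1) h.2⟩⟩
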